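/- Let $N\ge 1$, let $\beta\in\mathbb{C}$ be a coupling constant, let $\tau$ lie in the upper half plane and put $p=e^{2\pi\sqrt{-1}\tau}$. Set $$\theta_1(x)=2\sum_{n\ge1}(-1)^{n-1}e^{\tau\pi\sqrt{-1}(n-1/2)^2}\sin((2n-1)\pi x),\qquad \theta(x)=\frac{\theta_1(x)}{\theta_1'(0)},$$ let $\wp$ be the Weierstrass function with period lattice $2\pi\mathbb{Z}+2\pi\tau\mathbb{Z}$, and put $$\Theta(x)=\prod_{1\le i<j\le N}\theta\Bigl(\frac{x_i-x_j}{2\pi}\Bigr),\qquad \tilde\Delta(x)=\prod_{1\le i<j\le N}\sin^{\beta}\Bigl(\frac{x_i-x_j}{2}\Bigr).$$ Consider the Hamiltonian of the $A_{N-1}$ elliptic Calogero-Moser model $$\mathcal H=-\frac12\sum_{i=1}^N\frac{\partial^2}{\partial x_i^2}+\beta(\beta-1)\sum_{1\le i<j\le N}\wp(x_i-x_j)$$ and the Hasegawa operators $(1\le i\le N)$ $$\hat{\mathcal H}_i=\sum_{|I|=i}\ \sum_{J\subset I}\frac{\bigl(\prod_{j\in J}\beta\frac{\partial}{\partial x_j}\bigr)\Theta(x)}{\Theta(x)}\prod_{j\in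 I\setminus J}\frac{\partial}{\partial x_j},\qquad \mathcal H_i=\Theta^{\beta}\,\hat{\mathcal H}_i\,\Theta^{-\beta},$$ where $I$ runs over the subsets of $\{1,\dots,N\}$ with $i$ elements. Put $T(p)=\tilde\Delta^{-1}\mathcal H\tilde\Delta$ and $H^{(i)}(p)=\tilde\Delta^{-1}\mathcal H_i\tilde\Delta$. In these conjugations any local branches of the powers may be used: the resulting differential operators do not depend on them, and on $\mathbb{R}^N$ they have single-valued real-analytic coefficients off the hyperplanes $x_j-x_k\in2\pi\mathbb{Z}$ $(j\ne k)$. For $p=0$ the operators $T(0)$ and $H^{(i)}(0)$ are defined in the same way with the limits $\theta(x)=\sin(\pi x)/\pi$ and $\wp(x)=\frac{1}{4\sin^2(x/2)}-\frac1{12}$. Let $C^\omega(T)^W$ be the space of real-analytic functions $f:\mathbb{R}^N\to\mathbb{C}$ such that $f$ is invariant under all permutations of $x_1,\dots,x_N$, $f(x+u\sum_{i}\epsilon_i)=f(x)$ for all $u\in\mathbb{R}$, and $f(x+2\pi(\epsilon_i-\epsilon_j))=f(x)$ for all $i,j$, where $\epsilon_1,\dots,\epsilon_N$ is the standard basis;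 these are the Weyl-invariant real-analytic functions on the torus $T=\mathfrak h_{\mathbb R}/2\pi Q^\vee$ of type $A_{N-1}$. Then for every $p$ with $|p|<1$ the operator $T(p)$ and the operators $H^{(i)}(p)$, $1\le i\le N$, preserve $C^\omega(T)^W$: for every $f\in C^\omega(T)^W$, the function $T(p)f$, respectively $H^{(i)}(p)f$, which is defined off the hyperplanes $x_j-x_k\in2\pi\mathbb{Z}$ $(j\neq k)$, extends to a unique element of $C^\omega(T)^W$. -/

import Mathlib

namespace EllipticCM

noncomputable section

open Complex

/-! ### Theta function and Weierstrass function -/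

/-- `θ₁(x) = 2 ∑_{n ≥ 1} (-1)^{n-1} exp (π i τ (n - 1/2)²) sin ((2n - 1) π x)`,
with the summation index shifted to start at `0`. -/
def thetaOne (τ : UpperHalfPlane) (x : ℂ) : ℂ :=
  2 * ∑' n : ℕ, (-1 : ℂ) ^ n * Complex.exp ((τ : ℂ) * Real.pi * I * ((n : ℂ) + 1 / 2) ^ 2) *
    Complex.sin ((2 * (n : ℂ) + 1) * Real.pi * x)

/-- The normalized theta function `θ(x) = θ₁(x) / θ₁'(0)`. -/
def theta (τ : UpperHalfPlane) (x : ℂ) : ℂ :=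
  thetaOne τ x / deriv (thetaOne τ) 0

/-- The pair of (full) periods `2π`, `2πτ`. -/
def periods (τ : UpperHalfPlane) : PeriodPair where
  ω₁ := 2 * Real.pi
  ω₂ := 2 * Real.pi * (τ : ℂ)
  indep := by
    rw [LinearIndependent.pair_iff]
    intro s t h
    have him := congrArg Complex.im h
    have hre := congrArg Complex.re h
    have hτ : (τ : ℂ).im ≠ 0 := τ.im_pos.ne'
    simp at him hre
    have ht : t = 0 := by
      rcases him with h | h
      · exact h
      · exact absurd h hτ
    subst ht
    simpa [Real.pi_ne_zero] using hre

/-- The Weierstrass function `℘(x; π, πτ)` (half periods `π`, `πτ`). -/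
def wp (τ : UpperHalfPlane) (x : ℂ) : ℂ :=
  (periods τ).weierstrassP x

/-- The limit `p → 0` of the normalized theta function, `p = exp (2π i τ)`. -/
def thetaTrig (x : ℂ) : ℂ := Complex.sin (Real.pi * x) / Real.pi

/-- The limit `p → 0` of the Weierstrass function, `p = exp (2π i τ)`. -/
def wpTrig (x : ℂ) : ℂ := 1 / (4 * Complex.sin (x / 2) ^ 2) - 1 / 12

/-! ### Functions on the torus -/

/-- Complex-valued functions of the real coordinates `x₁, …, x_N`. -/
abbrev Fn (N : ℕ) : Type := (Fin N → ℝ) → ℂ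

/-- `C^ω(T)^W`, for `T = 𝔥_ℝ / 2π Q^∨` of type `A_{N-1}`, realized as functions on `ℝ^N`. -/
structure IsAnalyticTorusInvariant {N : ℕ} (f : Fn N) : Prop where
  analytic : AnalyticOnNhd ℝ f Set.univ
  symmetric : ∀ (σ : Equiv.Perm (Fin N)) (x : Fin N → ℝ), f (x ∘ σ) = f x
  translation : ∀ (u : ℝ) (x : Fin N → ℝ), f (fun j => x j + u) = f x
  periodic : ∀ (i j : Fin N) (x : Fin N → ℝ),
    f (x + (2 * Real.pi) • (Pi.single i (1 : ℝ) - Pi.single j (1 : ℝ))) = f x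

/-- The points off the singular hyperplanes `x_j - x_k ∈ 2πℤ`, `j ≠ k`. -/
def regularSet (N : ℕ) : Set (Fin N → ℝ) :=
  {x | ∀ j k : Fin N, j ≠ k → ∀ m : ℤ, x j - x k ≠ 2 * Real.pi * m}

/-- The operator `D`, whose coefficients are singular along the hyperplanes `x_j - x_k ∈ 2πℤ`,
preserves `C^ω(T)^W`: for each `f` in this space, `D f` (a function off the hyperplanes) is the
restriction of an element of this space, necessarily unique. -/
def Preserves {N : ℕ} (D : Fn N → Fn N) : Prop :=
  ∀ f : Fn N, IsAnalyticTorusInvariant f →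
    ∃! g : Fn N, IsAnalyticTorusInvariant g ∧ ∀ x ∈ regularSet N, g x = D f x

/-! ### Differential operators -/

/-- `∂f/∂x_j`. -/
def partialD {N : ℕ} (j : Fin N) (f : Fn N) : Fn N :=
  fun x => lineDeriv ℝ f x (Pi.single j (1 : ℝ))

/-- `(∏_{j ∈ J} ∂/∂x_j) f`. -/
def prodPartialD {N : ℕ} (J : Finset (Fin N)) (f : Fn N) : Fn N :=
  J.sort.foldr partialD f

/-- The conjugated operator `u^{-s} D u^s`, where at a point `x` with `u x ≠ 0` the (possibly
multivalued) function `u^s` is represented near `x` by the branch `y ↦ (u y / u x)^s`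
normalized to be `1` at `x` (principal power of a quantity close to `1`); for a differential
operator `D` the result does not depend on the normalization of the branch. -/
def conjPow {N : ℕ} (u : Fn N) (s : ℂ) (D : Fn N → Fn N) : Fn N → Fn N :=
  fun f x => D (fun y => (u y / u x) ^ s * f y) x

/-- `∏_{i < j} φ(x_i - x_j)`. -/
def pairProd {N : ℕ} (φ : ℂ → ℂ) : Fn N :=
  fun x => ∏ ij : Fin N × Fin N with ij.1 < ij.2, φ ((x ij.1 - x ij.2 : ℝ) : ℂ)

/-- `Θ(x) = ∏_{i < j} θ((x_i - x_j) / 2π)`. -/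
def bigTheta {N : ℕ} (θ : ℂ → ℂ) : Fn N :=
  pairProd fun z => θ (z / (2 * Real.pi))

/-- `∏_{i < j} sin((x_i - x_j) / 2)`; its `β`-th power is the gauge factor `Δ̃`. -/
def sinProd (N : ℕ) : Fn N :=
  pairProd fun z => Complex.sin (z / 2)

/-- The Hamiltonian `ℋ = -½ ∑ ∂²/∂x_i² + β(β-1) ∑_{i<j} ℘(x_i - x_j)`. -/
def hamiltonian {N : ℕ} (β : ℂ) (P : ℂ → ℂ) (f : Fn N) : Fn N :=
  fun x => -(1 / 2) * ∑ i : Fin N, partialD i (partialD i f) x +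
    β * (β - 1) *
      (∑ ij : Fin N × Fin N with ij.1 < ij.2, P ((x ij.1 - x ij.2 : ℝ) : ℂ)) * f x

/-- Hasegawa's operator
`ℋ̂_i = ∑_{|I| = i} ∑_{J ⊆ I} ((∏_{j ∈ J} β ∂_j) Θ / Θ) ∏_{j ∈ I \ J} ∂_j`. -/
def hasegawaHat {N : ℕ} (β : ℂ) (θ : ℂ → ℂ) (i : ℕ) (f : Fn N) : Fn N :=
  fun x => ∑ I ∈ (Finset.univ : Finset (Fin N)).powersetCard i, ∑ J ∈ I.powerset,
    β ^ J.card * prodPartialD J (bigTheta θ) x / bigTheta θ x * prodPartialD (I \ J) f x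

/-- `ℋ_i = Θ^β ℋ̂_i Θ^{-β}`. -/
def hasegawa {N : ℕ} (β : ℂ) (θ : ℂ → ℂ) (i : ℕ) : Fn N → Fn N :=
  conjPow (bigTheta θ) (-β) (hasegawaHat β θ i)

/-- The gauge-transformed Hamiltonian `T(p) = Δ̃⁻¹ ℋ Δ̃`. -/
def gaugedHamiltonian (N : ℕ) (β : ℂ) (P : ℂ → ℂ) : Fn N → Fn N :=
  conjPow (sinProd N) β (hamiltonian β P)

/-- The gauge-transformed Hasegawa operator `H^{(i)}(p) = Δ̃⁻¹ ℋ_i Δ̃`. -/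
def gaugedHasegawa (N : ℕ) (β : ℂ) (θ : ℂ → ℂ) (i : ℕ) : Fn N → Fn N :=
  conjPow (sinProd N) β (hasegawa β θ i)

end

end EllipticCM

section

open Complex Filter Topology

/-! ### Division of analytic functions by linear forms -/

section Division

variable {E : Type*} [NormedAddCommGroup E] [NormedSpace ℝ E]

theorem ContinuousMultilinearMap.sub_eq_sum_curryMid {m : ℕ}
    (p : ContinuousMultilinearMap ℝ (fun _ : Fin (m + 1) => E) ℂ) (L : E →L[ℝ] ℝ) (e v : E)
    (π : E →L[ℝ] E) (hπ : ∀ w, w - π w = L w • e) :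
    p (fun _ => v) - p (fun _ => π v) =
      (L v : ℂ) * ∑ k : Fin (m + 1), (p.compContinuousLinearMap (fun i => if i < k then π else
        ContinuousLinearMap.id ℝ E)).curryMid k e (fun _ => v) := by
  classical
  let a : ℕ → Fin (m + 1) → E := fun k i => if (i : ℕ) < k then π v else v
  have h0 : a 0 = fun _ => v := by funext i; simp [a]
  have h1 : a (m + 1) = fun _ => π v := by
    funext i; simp only [a]; rw [if_pos i.2]
  have key : ∀ k : Fin (m + 1), p (a k) - p (a (k + 1)) =
      (L v : ℂ) * (p.compContinuousLinearMap (fun i => if i < k then π else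
        ContinuousLinearMap.id ℝ E)).curryMid k e (fun _ => v) := by
    intro k
    have e1 : a k = Function.update (a k) k v := by
      funext i
      by_cases hi : i = k
      · subst hi; simp [a]
      · simp [Function.update_of_ne hi]
    have e2 : a (k + 1) = Function.update (a k) k (π v) := by
      funext i
      by_cases hi : i = k
      · subst hi; simp [a]
      · have : (i : ℕ) ≠ k := fun h => hi (Fin.ext h)
        have h3 : (i : ℕ) < k + 1 ↔ (i : ℕ) < k := by omega
        simp only [Function.update_of_ne hi, a, h3]
    have e3 : (p.compContinuousLinearMap (fun i => if i < k then π else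
        ContinuousLinearMap.id ℝ E)).curryMid k e (fun _ => v) =
        p (Function.update (a k) k e) := by
      rw [ContinuousMultilinearMap.curryMid_apply,
        ContinuousMultilinearMap.compContinuousLinearMap_apply]
      congr 1
      funext i
      by_cases hi : i = k
      · subst hi; simp
      · obtain ⟨j, rfl⟩ := Fin.exists_succAbove_eq hi
        rw [Fin.insertNth_apply_succAbove, Function.update_of_ne hi]
        simp only [a, Fin.lt_def]
        split_ifs <;> simp
    rw [e3, e2]
    nth_rewrite 1 [e1]
    rw [← ContinuousMultilinearMap.map_update_sub, hπ, ContinuousMultilinearMap.map_update_smul]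
    simp
  rw [← h0, ← h1, Finset.mul_sum, ← Finset.sum_congr rfl fun k _ => key k,
    Fin.sum_univ_eq_sum_range (fun k => p (a k) - p (a (k + 1))), Finset.sum_range_sub']

/-- An analytic function vanishing on an affine hyperplane is locally divisible by an equation
of the hyperplane. -/
theorem AnalyticAt.exists_eq_mul_of_eq_zero {f : E → ℂ} {x₀ : E} (hf : AnalyticAt ℝ f x₀)
    (L : E →L[ℝ] ℝ) (e : E) (he : L e = 1) (hz : ∀ᶠ x in 𝓝 x₀, L x = L x₀ → f x = 0) :
    ∃ q : E → ℂ, AnalyticAt ℝ q x₀ ∧ ∀ᶠ x in 𝓝 x₀, f x = ((L x - L x₀ : ℝ) : ℂ) * q x := by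
  obtain ⟨p, hp⟩ := hf
  let π : E →L[ℝ] E := ContinuousLinearMap.id ℝ E - L.smulRight e
  have hπ : ∀ w, w - π w = L w • e := by intro w; simp [π]
  have hLπ : ∀ w, L (π w) = 0 := by intro w; simp [π, he]
  let q : FormalMultilinearSeries ℝ E ℂ := fun m =>
    ∑ k : Fin (m + 1), ((p (m + 1)).compContinuousLinearMap (fun i => if i < k then π else
        ContinuousLinearMap.id ℝ E)).curryMid k e
  obtain ⟨C, a, hC, ha, hb⟩ := p.le_mul_pow_of_radius_pos hp.radius_pos
  let M : ℝ := max ‖π‖ 1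
  have hM : 0 < M := lt_of_lt_of_le one_pos (le_max_right _ _)
  have hq : ∀ m, ‖q m‖ ≤ (m + 1) * (C * (a * M) ^ (m + 1) * ‖e‖) := by
    intro m
    refine (norm_sum_le _ _).trans ?_
    refine (Finset.sum_le_card_nsmul _ _ (C * (a * M) ^ (m + 1) * ‖e‖) fun k _ => ?_).trans ?_
    · refine (ContinuousLinearMap.le_opNorm _ _).trans ?_
      gcongr
      rw [ContinuousMultilinearMap.norm_curryMid]
      refine (ContinuousMultilinearMap.norm_compContinuousLinearMap_le _ _).trans ?_
      rw [mul_pow, ← mul_assoc]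
      gcongr
      · exact hb _
      · refine (Finset.prod_le_prod (g := fun _ => M) (fun _ _ => norm_nonneg _)
          fun i _ => ?_).trans (by simp)
        split_ifs
        · exact le_max_left _ _
        · exact ContinuousLinearMap.norm_id_le.trans (le_max_right _ _)
    · simp
  have hqr : 0 < q.radius := by
    have hs : Summable fun m : ℕ => ((m : ℝ) + 1) * (1 / 2 : ℝ) ^ (m + 1) := by
      have := summable_pow_mul_geometric_of_norm_lt_one (R := ℝ) 1
        (show ‖(1 / 2 : ℝ)‖ < 1 by norm_num)
      simpa using (summable_nat_add_iff 1).2 this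
    let r : NNReal := ⟨1 / (2 * (a * M)), by positivity⟩
    have hr : (0 : ENNReal) < r := by
      rw [ENNReal.coe_pos]
      exact show (0 : ℝ) < 1 / (2 * (a * M)) by positivity
    refine hr.trans_le (q.le_radius_of_summable_norm ?_)
    refine Summable.of_nonneg_of_le (fun m => by positivity) (fun m => ?_)
      (hs.mul_left (C * ‖e‖ * (2 * (a * M))))
    refine (mul_le_mul_of_nonneg_right (hq m) (by positivity)).trans (le_of_eq ?_)
    have : (r : ℝ) = 1 / (2 * (a * M)) := rfl
    rw [this, div_pow, div_pow, mul_pow 2, pow_succ (a * M), pow_succ 2]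
    field_simp
    simp
  have hQ := q.hasFPowerSeriesOnBall hqr
  have hQa : AnalyticAt ℝ q.sum 0 := ⟨q, hQ.hasFPowerSeriesAt⟩
  refine ⟨fun x => q.sum (x - x₀), ?_, ?_⟩
  · have : AnalyticAt ℝ (fun x : E => x - x₀) x₀ := analyticAt_id.sub analyticAt_const
    exact AnalyticAt.fun_comp (by simpa using hQa) this
  have ev1 : ∀ᶠ v in 𝓝 (0 : E), f (x₀ + v) = (L v : ℂ) * q.sum v := by
    have hsum := hp.eventually_hasSum
    have hπ0 : Tendsto π (𝓝 0) (𝓝 0) := by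
      simpa using π.continuous.tendsto 0
    have hsum2 := hπ0.eventually hsum
    have hz0 : ∀ᶠ v in 𝓝 (0 : E), L (x₀ + v) = L x₀ → f (x₀ + v) = 0 := by
      have : Tendsto (fun v : E => x₀ + v) (𝓝 0) (𝓝 x₀) := by
        have : Continuous fun v : E => x₀ + v := by fun_prop
        simpa using this.tendsto 0
      exact this.eventually hz
    have hz1 := hπ0.eventually hz0
    filter_upwards [hsum, hsum2, hz1, hQ.hasFPowerSeriesAt.eventually_hasSum] with v h1 h2 h3 h4
    rw [h3 (by simp [hLπ])] at h2
    have h5 := h1.sub h2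
    rw [sub_zero] at h5
    have h6 := (hasSum_nat_add_iff' 1).2 h5
    have h0 : ∀ w : Fin 0 → E, ∀ w', p 0 w = p 0 w' := fun w w' => by
      rw [Subsingleton.elim w w']
    simp only [Finset.sum_range_one] at h6
    rw [h0 (fun _ => v) (fun _ => π v), sub_self, sub_zero] at h6
    rw [zero_add] at h4
    refine h6.unique ?_
    convert! h4.mul_left (L v : ℂ) using 2 with m
    rw [ContinuousMultilinearMap.sub_eq_sum_curryMid (p (m + 1)) L e v π hπ]
    simp [q]
  have : Tendsto (fun x : E => x - x₀) (𝓝 x₀) (𝓝 0) := by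
    have : Continuous fun x : E => x - x₀ := by fun_prop
    simpa using this.tendsto x₀
  filter_upwards [this.eventually ev1] with x hx
  simpa using hx

end Division

/-- Local analytic extensions of a function defined on a dense set glue. -/
theorem exists_analyticOnNhd_of_dense {E : Type*} [NormedAddCommGroup E] [NormedSpace ℝ E]
    {A : Set E} (hA : Dense A) (F : E → ℂ)
    (h : ∀ x₀, ∃ k : E → ℂ, AnalyticAt ℝ k x₀ ∧ ∀ᶠ x in 𝓝 x₀, x ∈ A → F x = k x) :
    ∃ g : E → ℂ, AnalyticOnNhd ℝ g Set.univ ∧ ∀ x ∈ A, g x = F x := by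
  have key : ∀ x k, AnalyticAt ℝ k x → (∀ᶠ y in 𝓝 x, y ∈ A → F y = k y) →
      extendFrom A F x = k x := by
    intro x k hk hF
    refine extendFrom_eq (hA x) ?_
    refine (hk.continuousAt.tendsto.mono_left nhdsWithin_le_nhds).congr' ?_
    filter_upwards [mem_nhdsWithin_of_mem_nhds hF, self_mem_nhdsWithin] with y hy hyA
    exact (hy hyA).symm
  refine ⟨extendFrom A F, fun x₀ _ => ?_, fun x hx => ?_⟩
  · obtain ⟨k, hk, hF⟩ := h x₀
    refine hk.congr ?_
    filter_upwards [hk.eventually_analyticAt, hF.eventually_nhds] with y h1 h2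
    exact (key y k h1 h2).symm
  · obtain ⟨k, hk, hF⟩ := h x
    rw [key x k hk hF, hF.self_of_nhds hx]

theorem Real.cos_ne_zero_of_sin_eq_zero {z : ℝ} (h : Real.sin z = 0) : Real.cos z ≠ 0 := by
  intro hc
  have := Real.sin_sq_add_cos_sq z
  rw [h, hc] at this
  norm_num at this

theorem eventually_sin_half_ne_zero (z d : ℝ) (hd : d ≠ 0) :
    ∀ᶠ t in 𝓝[≠] (0 : ℝ), Real.sin ((z + t * d) / 2) ≠ 0 := by
  have hder : HasDerivAt (fun t : ℝ => Real.sin ((z + t * d) / 2))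
      (Real.cos ((z + 0 * d) / 2) * (1 * d / 2)) 0 :=
    ((((hasDerivAt_id (0 : ℝ)).mul_const d).const_add z).div_const 2).sin
  by_cases h : Real.sin (z / 2) = 0
  · refine hder.eventually_ne (c := 0) (mul_ne_zero (fun hc => ?_) (by simpa using hd))
    rw [zero_mul, add_zero] at hc
    exact Real.cos_ne_zero_of_sin_eq_zero h hc
  · exact (hder.continuousAt.eventually_ne (by simpa using h)).filter_mono nhdsWithin_le_nhds

theorem exists_sin_half_eq_mul (z₀ : ℝ) (h : Real.sin (z₀ / 2) = 0) :
    ∃ u : ℝ → ℂ, AnalyticAt ℝ u z₀ ∧ u z₀ = Real.cos (z₀ / 2) / 2 ∧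
      ∀ᶠ z in 𝓝 z₀, (Real.sin (z / 2) : ℂ) = ((z - z₀ : ℝ) : ℂ) * u z := by
  have han : AnalyticAt ℝ (fun z : ℝ => (Real.sin (z / 2) : ℂ)) z₀ := by
    have h1 : AnalyticAt ℝ (fun z : ℝ => Real.sin (z / 2)) z₀ := by fun_prop
    exact (Complex.ofRealCLM.analyticAt _).fun_comp h1
  obtain ⟨u, hu, he⟩ := han.exists_eq_mul_of_eq_zero (ContinuousLinearMap.id ℝ ℝ) 1 rfl
    (Eventually.of_forall fun x hx => by
      simp only [ContinuousLinearMap.id_apply] at hx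
      simp [hx, h])
  simp only [ContinuousLinearMap.id_apply] at he
  refine ⟨u, hu, ?_, he⟩
  have d1 : HasDerivAt (fun z : ℝ => (Real.sin (z / 2) : ℂ))
      ((Real.cos (z₀ / 2) * (1 / 2) : ℝ) : ℂ) z₀ :=
    (((hasDerivAt_id z₀).div_const 2).sin).ofReal_comp
  have d2 : HasDerivAt (fun z : ℝ => ((z - z₀ : ℝ) : ℂ) * u z)
      (((1 : ℝ) : ℂ) * u z₀ + ((z₀ - z₀ : ℝ) : ℂ) * deriv u z₀) z₀ :=
    (((hasDerivAt_id z₀).sub_const z₀).ofReal_comp).mul hu.differentiableAt.hasDerivAt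
  have := d1.unique (d2.congr_of_eventuallyEq he)
  rw [sub_self, Complex.ofReal_zero, zero_mul, add_zero, Complex.ofReal_one, one_mul] at this
  rw [← this]
  push_cast
  ring

namespace EllipticCM

variable {N : ℕ}

theorem mem_regularSet_iff {x : Fin N → ℝ} :
    x ∈ regularSet N ↔ ∀ j k, j ≠ k → Real.sin ((x j - x k) / 2) ≠ 0 := by
  refine forall_congr' fun j => forall_congr' fun k => imp_congr_right fun _ => ?_
  rw [Ne, Real.sin_eq_zero_iff, not_exists]
  refine forall_congr' fun m => not_congr ⟨fun h => by rw [h]; ring, fun h => by linarith⟩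

/-- A real-analytic function vanishing where `sin ((x_a - x_b) / 2)` does is divisible by it. -/
theorem exists_eq_sin_mul {G : Fn N} (hG : AnalyticOnNhd ℝ G Set.univ) {a b : Fin N} (hab : a ≠ b)
    (hz : ∀ x, Real.sin ((x a - x b) / 2) = 0 → G x = 0) :
    ∃ g : Fn N, AnalyticOnNhd ℝ g Set.univ ∧
      ∀ x, G x = (Real.sin ((x a - x b) / 2) : ℂ) * g x := by
  let L : (Fin N → ℝ) →L[ℝ] ℝ :=
    ContinuousLinearMap.proj (R := ℝ) (φ := fun _ : Fin N => ℝ) a - ContinuousLinearMap.proj b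
  have hL : ∀ x, L x = x a - x b := fun x => rfl
  have hA : Dense {x : Fin N → ℝ | Real.sin ((x a - x b) / 2) ≠ 0} := by
    intro x
    have ht : Tendsto (fun t : ℝ => x + t • (Pi.single a 1 : Fin N → ℝ)) (𝓝[≠] 0) (𝓝 x) := by
      have : Continuous fun t : ℝ => x + t • (Pi.single a 1 : Fin N → ℝ) := by fun_prop
      simpa using (this.tendsto 0).mono_left (nhdsWithin_le_nhds (s := {(0 : ℝ)}ᶜ))
    refine mem_closure_of_tendsto ht ?_
    filter_upwards [eventually_sin_half_ne_zero (x a - x b) 1 one_ne_zero] with t h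
    simpa [hab.symm, add_sub_right_comm] using h
  obtain ⟨g, hg, hgA⟩ := exists_analyticOnNhd_of_dense hA
    (fun x => G x / (Real.sin ((x a - x b) / 2) : ℂ)) (fun x₀ => by
      by_cases h0 : Real.sin ((x₀ a - x₀ b) / 2) = 0
      · obtain ⟨q, hq, hGq⟩ := (hG x₀ trivial).exists_eq_mul_of_eq_zero L (Pi.single a 1)
          (by simp [hL, hab.symm]) (Eventually.of_forall fun x hx => hz x (by
            rw [← hL, hx, hL]; exact h0))
        obtain ⟨u, hu, hu0', hsu⟩ := exists_sin_half_eq_mul _ h0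
        have hu0 : u (x₀ a - x₀ b) ≠ 0 := by
          rw [hu0']
          exact div_ne_zero (Complex.ofReal_ne_zero.2 (Real.cos_ne_zero_of_sin_eq_zero h0))
            two_ne_zero
        have hLa : Tendsto L (𝓝 x₀) (𝓝 (x₀ a - x₀ b)) := L.continuous.tendsto x₀
        have hua : AnalyticAt ℝ (fun x => u (L x)) x₀ :=
          AnalyticAt.fun_comp (f := L) (g := u) hu (L.analyticAt x₀)
        refine ⟨fun x => q x / u (L x), hq.div hua hu0, ?_⟩
        filter_upwards [hGq, hLa.eventually hsu,
          hua.continuousAt.eventually_ne (show u (L x₀) ≠ 0 from hu0)] with x h1 h2 h3 hx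
        have h4 : ((L x - (x₀ a - x₀ b) : ℝ) : ℂ) ≠ 0 := fun h => by
          rw [h, zero_mul] at h2
          exact hx (Complex.ofReal_eq_zero.1 h2)
        rw [hL x] at h2
        rw [h2, h1, ← hL x, ← hL x₀]
        rw [← hL x₀] at h4
        field_simp
      · refine ⟨fun x => G x / (Real.sin ((x a - x b) / 2) : ℂ), ?_, by simp⟩
        have h1 : AnalyticAt ℝ (fun x : Fin N → ℝ => (Real.sin ((x a - x b) / 2) : ℂ)) x₀ := by
          refine (Complex.ofRealCLM.analyticAt _).fun_comp
            (g := Complex.ofRealCLM) (f := fun x : Fin N → ℝ => Real.sin ((x a - x b) / 2)) ?_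
          exact Real.analyticAt_sin.fun_comp ((L.analyticAt x₀).div_const)
        exact (hG x₀ trivial).div h1 (Complex.ofReal_ne_zero.2 h0))
  refine ⟨g, hg, fun x => ?_⟩
  by_cases h0 : Real.sin ((x a - x b) / 2) = 0
  · rw [hz x h0, h0]; simp
  · rw [hgA x h0, mul_div_cancel₀ _ (Complex.ofReal_ne_zero.2 h0)]

theorem exists_eq_prod_sin_mul {G : Fn N} (hG : AnalyticOnNhd ℝ G Set.univ)
    (hz : ∀ x a b, a ≠ b → Real.sin ((x a - x b) / 2) = 0 → G x = 0)
    (s : Finset (Fin N × Fin N)) (hs : ∀ ij ∈ s, ij.1 < ij.2) :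
    ∃ g : Fn N, AnalyticOnNhd ℝ g Set.univ ∧
      ∀ x, G x = (∏ ij ∈ s, (Real.sin ((x ij.1 - x ij.2) / 2) : ℂ)) * g x := by
  classical
  induction s using Finset.induction_on with
  | empty => exact ⟨G, hG, by simp⟩
  | insert p s hp ih =>
    obtain ⟨g, hg, hGg⟩ := ih fun ij hij => hs ij (Finset.mem_insert_of_mem hij)
    obtain ⟨a, b⟩ := p
    have hab : a < b := hs (a, b) (Finset.mem_insert_self _ _)
    have hgz : ∀ x : Fin N → ℝ, Real.sin ((x a - x b) / 2) = 0 → g x = 0 := by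
      intro x hx
      let v : Fin N → ℝ := fun j => if j = b then (a : ℕ) else (j : ℕ)
      have hv : ∀ ij ∈ s, v ij.1 - v ij.2 ≠ 0 := by
        rintro ⟨i, j⟩ hij h
        have hlt : i < j := hs (i, j) (Finset.mem_insert_of_mem hij)
        have hne : ¬(i = a ∧ j = b) := by rintro ⟨rfl, rfl⟩; exact hp hij
        have h' : v i = v j := sub_eq_zero.1 h
        have ha : (a : ℕ) < b := hab
        have hl : (i : ℕ) < j := hlt
        simp only [v] at h'
        split_ifs at h' with h1 h2 h2
        · subst h1; subst h2; exact lt_irrefl _ hlt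
        · subst h1
          have := Nat.cast_injective h'
          omega
        · have := Nat.cast_injective h'
          exact hne ⟨Fin.ext this, h2⟩
        · have := Nat.cast_injective h'
          omega
      have hvab : v a = v b := by simp [v]
      have hcont : Continuous fun t : ℝ => g (x + t • v) :=
        (hg.continuous).comp (by fun_prop)
      have ht : Tendsto (fun t : ℝ => g (x + t • v)) (𝓝[≠] 0) (𝓝 (g x)) := by
        simpa using (hcont.tendsto 0).mono_left (nhdsWithin_le_nhds (s := {(0 : ℝ)}ᶜ))
      refine tendsto_nhds_unique ht (tendsto_const_nhds.congr' ?_)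
      have hall : ∀ᶠ t in 𝓝[≠] (0 : ℝ), ∀ ij ∈ s,
          Real.sin ((x ij.1 - x ij.2 + t * (v ij.1 - v ij.2)) / 2) ≠ 0 :=
        (Finset.eventually_all s).2 fun ij hij => eventually_sin_half_ne_zero _ _ (hv ij hij)
      filter_upwards [hall] with t htt
      have h0 : G (x + t • v) = 0 := hz _ a b hab.ne (by simpa [hvab] using hx)
      rw [hGg] at h0
      refine ((mul_eq_zero.1 h0).resolve_left (Finset.prod_ne_zero_iff.2 fun ij hij => ?_)).symm
      have := htt ij hij
      rw [Complex.ofReal_ne_zero]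
      convert! this using 3
      simp only [Pi.add_apply, Pi.smul_apply, smul_eq_mul]
      ring
    obtain ⟨k, hk, hgk⟩ := exists_eq_sin_mul hg hab.ne hgz
    refine ⟨k, hk, fun x => ?_⟩
    rw [hGg, hgk, Finset.prod_insert hp]
    ring

theorem sinProd_eq (x : Fin N → ℝ) :
    sinProd N x = ∏ ij : Fin N × Fin N with ij.1 < ij.2,
      (Real.sin ((x ij.1 - x ij.2) / 2) : ℂ) := by
  simp [sinProd, pairProd]

/-- A real-analytic function vanishing on all the singular hyperplanes is divisible by the product
of sines. -/
theorem exists_eq_sinProd_mul {G : Fn N} (hG : AnalyticOnNhd ℝ G Set.univ)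
    (hz : ∀ x a b, a ≠ b → Real.sin ((x a - x b) / 2) = 0 → G x = 0) :
    ∃ g : Fn N, AnalyticOnNhd ℝ g Set.univ ∧ ∀ x, G x = sinProd N x * g x := by
  obtain ⟨g, hg, h⟩ := exists_eq_prod_sin_mul hG hz
    (Finset.univ.filter fun ij : Fin N × Fin N => ij.1 < ij.2) (by simp)
  exact ⟨g, hg, fun x => by rw [h, sinProd_eq]⟩

theorem dense_regularSet : Dense (regularSet N) := by
  intro x
  let v : Fin N → ℝ := fun j => (j : ℕ)
  have ht : Tendsto (fun t : ℝ => x + t • v) (𝓝[≠] 0) (𝓝 x) := by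
    have : Continuous fun t : ℝ => x + t • v := by fun_prop
    simpa using (this.tendsto 0).mono_left (nhdsWithin_le_nhds (s := {(0 : ℝ)}ᶜ))
  refine mem_closure_of_tendsto ht ?_
  have hall : ∀ᶠ t in 𝓝[≠] (0 : ℝ), ∀ j k : Fin N, j ≠ k →
      Real.sin ((x j - x k + t * (v j - v k)) / 2) ≠ 0 := by
    refine eventually_all.2 fun j => eventually_all.2 fun k => ?_
    by_cases hjk : j = k
    · simp [hjk]
    · filter_upwards [eventually_sin_half_ne_zero (x j - x k) (v j - v k) (sub_ne_zero.2 fun h =>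
        hjk (Fin.ext (Nat.cast_injective h)))] with t h _ using h
  filter_upwards [hall] with t h
  refine mem_regularSet_iff.2 fun j k hjk => ?_
  convert! h j k hjk using 3
  simp only [Pi.add_apply, Pi.smul_apply, smul_eq_mul]
  ring

theorem sinProd_ne_zero_iff {x : Fin N → ℝ} : sinProd N x ≠ 0 ↔ x ∈ regularSet N := by
  rw [sinProd_eq, Finset.prod_ne_zero_iff, mem_regularSet_iff]
  simp only [Finset.mem_filter, Finset.mem_univ, true_and, Prod.forall, Ne, Complex.ofReal_eq_zero]
  refine ⟨fun h j k hjk => ?_, fun h j k hjk => h j k hjk.ne⟩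
  rcases lt_or_gt_of_ne hjk with h1 | h1
  · exact h j k h1
  · have := h k j h1
    rwa [← neg_sub, neg_div, Real.sin_neg, neg_eq_zero]

/-! ### Partial derivatives -/

theorem partialD_eq_fderiv {f : Fn N} {x : Fin N → ℝ} (hf : AnalyticAt ℝ f x) (j : Fin N) :
    partialD j f x = fderiv ℝ f x (Pi.single j 1) :=
  hf.differentiableAt.lineDeriv_eq_fderiv

theorem partialD_eventuallyEq_fderiv {f : Fn N} {x : Fin N → ℝ} (hf : AnalyticAt ℝ f x)
    (j : Fin N) : partialD j f =ᶠ[𝓝 x] fun y => fderiv ℝ f y (Pi.single j 1) :=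
  hf.eventually_analyticAt.mono fun _ hy => partialD_eq_fderiv hy j

theorem _root_.AnalyticAt.partialD {f : Fn N} {x : Fin N → ℝ} (hf : AnalyticAt ℝ f x) (j : Fin N) :
    AnalyticAt ℝ (EllipticCM.partialD j f) x :=
  (((ContinuousLinearMap.apply ℝ ℂ (Pi.single j (1 : ℝ))).analyticAt _).fun_comp hf.fderiv).congr
    (partialD_eventuallyEq_fderiv hf j).symm

theorem _root_.Filter.EventuallyEq.partialD {f g : Fn N} {x : Fin N → ℝ} (h : f =ᶠ[𝓝 x] g)
    (j : Fin N) : EllipticCM.partialD j f =ᶠ[𝓝 x] EllipticCM.partialD j g :=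
  h.eventuallyEq_nhds.mono fun _ hy => hy.lineDeriv_eq

theorem partialD_mul {f g : Fn N} {x : Fin N → ℝ} (hf : AnalyticAt ℝ f x) (hg : AnalyticAt ℝ g x)
    (j : Fin N) : partialD j (fun y => f y * g y) x = partialD j f x * g x + f x * partialD j g x := by
  rw [partialD_eq_fderiv (hf.fun_mul hg), partialD_eq_fderiv hf, partialD_eq_fderiv hg,
    fderiv_fun_mul hf.differentiableAt hg.differentiableAt]
  simp
  ring

theorem partialD_add {f g : Fn N} {x : Fin N → ℝ} (hf : AnalyticAt ℝ f x) (hg : AnalyticAt ℝ g x)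
    (j : Fin N) : partialD j (fun y => f y + g y) x = partialD j f x + partialD j g x := by
  rw [partialD_eq_fderiv (hf.fun_add hg), partialD_eq_fderiv hf, partialD_eq_fderiv hg,
    fderiv_fun_add hf.differentiableAt hg.differentiableAt]
  simp

theorem partialD_const_mul (a : ℂ) (f : Fn N) (j : Fin N) :
    partialD j (fun y => a * f y) = fun x => a * partialD j f x := by
  funext x
  exact deriv_const_mul_field a

theorem partialD_comm {f : Fn N} {x : Fin N → ℝ} (hf : AnalyticAt ℝ f x) (i j : Fin N) :
    partialD i (partialD j f) x = partialD j (partialD i f) x := by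
  have h : ∀ i j : Fin N, partialD i (partialD j f) x =
      fderiv ℝ (fderiv ℝ f) x (Pi.single i 1) (Pi.single j 1) := by
    intro i j
    have han : AnalyticAt ℝ (fun y => fderiv ℝ f y (Pi.single j 1)) x :=
      ((ContinuousLinearMap.apply ℝ ℂ (Pi.single j (1 : ℝ))).analyticAt _).fun_comp hf.fderiv
    rw [((partialD_eventuallyEq_fderiv hf j).partialD i).eq_of_nhds, partialD_eq_fderiv han,
      fderiv_clm_apply hf.fderiv.differentiableAt (differentiableAt_const _)]
    simp
  rw [h, h]
  exact (hf.contDiffAt (n := ⊤)).isSymmSndFDerivAt (by simp) _ _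

/-- Iterated partial derivative along a list of indices. -/
noncomputable def iterPartialD (l : List (Fin N)) (f : Fn N) : Fn N := l.foldr partialD f

@[simp] theorem iterPartialD_cons (j : Fin N) (l : List (Fin N)) (f : Fn N) :
    iterPartialD (j :: l) f = partialD j (iterPartialD l f) := rfl

theorem _root_.AnalyticAt.iterPartialD {f : Fn N} {x : Fin N → ℝ} (hf : AnalyticAt ℝ f x)
    (l : List (Fin N)) : AnalyticAt ℝ (EllipticCM.iterPartialD l f) x := by
  induction l with
  | nil => exact hf
  | cons j l ih => exact ih.partialD j

theorem _root_.Filter.EventuallyEq.iterPartialD {f g : Fn N} {x : Fin N → ℝ} (h : f =ᶠ[𝓝 x] g)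
    (l : List (Fin N)) : EllipticCM.iterPartialD l f =ᶠ[𝓝 x] EllipticCM.iterPartialD l g := by
  induction l with
  | nil => exact h
  | cons j l ih => exact ih.partialD j

theorem iterPartialD_const_mul (a : ℂ) (f : Fn N) (l : List (Fin N)) :
    iterPartialD l (fun y => a * f y) = fun x => a * iterPartialD l f x := by
  induction l with
  | nil => rfl
  | cons j l ih => rw [iterPartialD_cons, ih, partialD_const_mul]; rfl

theorem iterPartialD_perm {l l' : List (Fin N)} (h : l.Perm l') {f : Fn N} {x : Fin N → ℝ}
    (hf : AnalyticAt ℝ f x) : iterPartialD l f =ᶠ[𝓝 x] iterPartialD l' f := by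
  induction h with
  | nil => rfl
  | cons j _ ih => exact ih.partialD j
  | swap i j l =>
    exact (hf.iterPartialD l).eventually_analyticAt.mono fun y hy => partialD_comm hy j i
  | trans _ _ ih₁ ih₂ => exact ih₁.trans ih₂

/-! ### The extended affine symmetries -/

/-- The affine map `x ↦ x ∘ σ + c`. -/
def symMap (σ : Equiv.Perm (Fin N)) (c : Fin N → ℝ) (x : Fin N → ℝ) : Fin N → ℝ :=
  fun j => x (σ j) + c j

/-- The translations under which the functions on the torus are invariant. -/
def IsShift (c : Fin N → ℝ) : Prop :=
  (∃ u : ℝ, c = fun _ => u) ∨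
    ∃ i j : Fin N, c = (2 * Real.pi) • (Pi.single i (1 : ℝ) - Pi.single j (1 : ℝ))

theorem IsShift.exists_int {c : Fin N → ℝ} (h : IsShift c) :
    ∃ (u : ℝ) (d : Fin N → ℤ), ∑ j, d j = 0 ∧ ∀ j, c j = u + 2 * Real.pi * d j := by
  rcases h with ⟨u, rfl⟩ | ⟨i, j, rfl⟩
  · exact ⟨u, 0, by simp, by simp⟩
  · refine ⟨0, Pi.single i 1 - Pi.single j 1, by simp, fun k => ?_⟩
    simp [Pi.single_apply]

theorem continuous_symMap (σ : Equiv.Perm (Fin N)) (c : Fin N → ℝ) : Continuous (symMap σ c) := by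
  unfold symMap; fun_prop

theorem partialD_comp_symMap (σ : Equiv.Perm (Fin N)) (c : Fin N → ℝ) (f : Fn N) (j : Fin N) :
    partialD j (fun y => f (symMap σ c y)) =
      fun x => partialD (σ.symm j) f (symMap σ c x) := by
  funext x
  have : ∀ t : ℝ, symMap σ c (x + t • Pi.single j 1) =
      symMap σ c x + t • Pi.single (σ.symm j) 1 := by
    intro t
    funext k
    simp only [symMap, Pi.add_apply, Pi.smul_apply, Pi.single_apply, ← Equiv.eq_symm_apply]
    ring
  simp only [partialD, lineDeriv, this]

theorem iterPartialD_comp_symMap (σ : Equiv.Perm (Fin N)) (c : Fin N → ℝ) (f : Fn N)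
    (l : List (Fin N)) : iterPartialD l (fun y => f (symMap σ c y)) =
      fun x => iterPartialD (l.map σ.symm) f (symMap σ c x) := by
  induction l with
  | nil => rfl
  | cons j l ih => rw [iterPartialD_cons, ih, partialD_comp_symMap]; rfl

theorem prodPartialD_comp_symMap (σ : Equiv.Perm (Fin N)) (c : Fin N → ℝ) {f : Fn N}
    {x : Fin N → ℝ} (hf : AnalyticAt ℝ f (symMap σ c x)) (J : Finset (Fin N)) :
    prodPartialD J (fun y => f (symMap σ c y)) x =
      prodPartialD (J.map σ.symm.toEmbedding) f (symMap σ c x) := by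
  have h := congrFun (iterPartialD_comp_symMap σ c f J.sort) x
  refine h.trans (iterPartialD_perm ?_ hf).eq_of_nhds
  refine (List.perm_ext_iff_of_nodup ?_ (Finset.sort_nodup _ _)).2 fun a => ?_
  · exact (Finset.sort_nodup _ _).map σ.symm.injective
  · simp [Equiv.symm_apply_eq]

theorem IsAnalyticTorusInvariant.comp_symMap {f : Fn N} (hf : IsAnalyticTorusInvariant f)
    (σ : Equiv.Perm (Fin N)) {c : Fin N → ℝ} (hc : IsShift c) (x : Fin N → ℝ) :
    f (symMap σ c x) = f x := by
  rcases hc with ⟨u, rfl⟩ | ⟨i, j, rfl⟩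
  · exact (hf.translation u (x ∘ σ)).trans (hf.symmetric σ x)
  · exact (hf.periodic i j (x ∘ σ)).trans (hf.symmetric σ x)

theorem isAnalyticTorusInvariant_of_symMap {f : Fn N} (h : AnalyticOnNhd ℝ f Set.univ)
    (hf : ∀ σ c, IsShift c → ∀ x, f (symMap σ c x) = f x) : IsAnalyticTorusInvariant f where
  analytic := h
  symmetric σ x := by
    have := hf σ 0 (Or.inl ⟨0, rfl⟩) x
    rwa [show symMap σ 0 x = x ∘ σ from funext fun j => add_zero _] at this
  translation u x := hf 1 _ (Or.inl ⟨u, rfl⟩) x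
  periodic i j x := hf 1 _ (Or.inr ⟨i, j, rfl⟩) x

/-! ### Products over pairs -/

@[to_additive]
theorem prod_pairs_comp {M : Type*} [CommMonoid M] (σ : Equiv.Perm (Fin N)) (F : Fin N → Fin N → M)
    (hF : ∀ i j, F i j = F j i) :
    ∏ ij : Fin N × Fin N with ij.1 < ij.2, F (σ ij.1) (σ ij.2) =
      ∏ ij : Fin N × Fin N with ij.1 < ij.2, F ij.1 ij.2 := by
  let φ : Equiv.Perm (Fin N) → Fin N × Fin N → Fin N × Fin N := fun σ ij =>
    if σ ij.1 < σ ij.2 then (σ ij.1, σ ij.2) else (σ ij.2, σ ij.1)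
  have hmem : ∀ σ : Equiv.Perm (Fin N), ∀ ij : Fin N × Fin N, ij.1 < ij.2 →
      (φ σ ij).1 < (φ σ ij).2 := by
    intro σ ij h
    simp only [φ]
    split_ifs with h1
    · exact h1
    · exact lt_of_le_of_ne (not_lt.1 h1) fun h2 => h.ne' (σ.injective h2)
  have hinv : ∀ σ : Equiv.Perm (Fin N), ∀ ij : Fin N × Fin N, ij.1 < ij.2 →
      φ σ.symm (φ σ ij) = ij := by
    rintro σ ⟨i, j⟩ h
    have h' : i < j := h
    simp only [φ]
    split_ifs with h1 h2 h2 <;> simp_all [not_lt.2 h'.le]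
  refine Finset.prod_nbij' (φ σ) (φ σ.symm) (fun ij h => ?_) (fun ij h => ?_) (fun ij h => ?_)
    (fun ij h => ?_) (fun ij h => ?_)
  · simpa using hmem σ ij (by simpa using h)
  · simpa using hmem σ.symm ij (by simpa using h)
  · exact hinv σ ij (by simpa using h)
  · simpa using hinv σ.symm ij (by simpa using h)
  · simp only [φ]
    split_ifs
    · rfl
    · exact hF _ _

theorem prod_pairs_comp_sign (σ : Equiv.Perm (Fin N)) (F : Fin N → Fin N → ℂ)
    (hF : ∀ i j, F i j = -F j i) :
    ∏ ij : Fin N × Fin N with ij.1 < ij.2, F (σ ij.1) (σ ij.2) =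
      ((Equiv.Perm.sign σ : ℤ) : ℂ) * ∏ ij : Fin N × Fin N with ij.1 < ij.2, F ij.1 ij.2 := by
  have h : ∀ G : Fin N → Fin N → ℂ, ∏ ij : Fin N × Fin N with ij.1 < ij.2, G ij.1 ij.2 =
      ∏ i, ∏ j ∈ Finset.Ioi i, G i j := by
    intro G
    rw [Finset.prod_filter, Fintype.prod_prod_type]
    refine Finset.prod_congr rfl fun i _ => ?_
    rw [← Finset.prod_filter]
    refine Finset.prod_congr ?_ fun _ _ => rfl
    ext; simp
  rw [h fun i j => F (σ i) (σ j), h, σ.prod_Ioi_comp_eq_sign_mul_prod hF]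

theorem prod_pairs_mul {M : Type*} [CommMonoid M] (w : Fin N → M) :
    ∏ ij : Fin N × Fin N with ij.1 < ij.2, w ij.1 * w ij.2 = (∏ j, w j) ^ (N - 1) := by
  have h1 : ∏ ij : Fin N × Fin N with ij.1 < ij.2, w ij.2 =
      ∏ ij : Fin N × Fin N with ij.2 < ij.1, w ij.1 :=
    Finset.prod_nbij' Prod.swap Prod.swap (by simp) (by simp) (by simp) (by simp) (by simp)
  have h2 : ∏ ij : Fin N × Fin N with ij.1 ≠ ij.2, w ij.1 = (∏ j, w j) ^ (N - 1) := by
    rw [Finset.prod_filter, Fintype.prod_prod_type, ← Finset.prod_pow]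
    refine Finset.prod_congr rfl fun i _ => ?_
    rw [← Finset.prod_filter]
    simp only [Finset.prod_const, Finset.filter_ne]
    simp
  rw [Finset.prod_mul_distrib, h1, ← h2, ← Finset.prod_union]
  · refine Finset.prod_congr ?_ fun _ _ => rfl
    ext ij
    simp [lt_or_lt_iff_ne]
  · rw [Finset.disjoint_filter]
    exact fun ij _ h h' => lt_asymm h h'

theorem exists_int_symMap_sub {c : Fin N → ℝ} (hc : IsShift c) :
    ∃ d : Fin N → ℤ, ∑ j, d j = 0 ∧ ∀ (σ : Equiv.Perm (Fin N)) (x : Fin N → ℝ) (i j : Fin N),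
      symMap σ c x i - symMap σ c x j = x (σ i) - x (σ j) + 2 * Real.pi * ((d i - d j : ℤ) : ℝ) := by
  obtain ⟨u, d, hd, h⟩ := hc.exists_int
  refine ⟨d, hd, fun σ x i j => ?_⟩
  simp only [symMap, h]
  push_cast
  ring

theorem sinProd_symMap (σ : Equiv.Perm (Fin N)) {c : Fin N → ℝ} (hc : IsShift c)
    (x : Fin N → ℝ) :
    sinProd N (symMap σ c x) = ((Equiv.Perm.sign σ : ℤ) : ℂ) * sinProd N x := by
  obtain ⟨d, hd, h⟩ := exists_int_symMap_sub hc
  have hs : ∀ i j, (Real.sin ((symMap σ c x i - symMap σ c x j) / 2) : ℂ) =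
      ((-1) ^ d i * (-1) ^ d j) * (Real.sin ((x (σ i) - x (σ j)) / 2) : ℂ) := by
    intro i j
    rw [h, show (x (σ i) - x (σ j) + 2 * Real.pi * ((d i - d j : ℤ) : ℝ)) / 2 =
      (x (σ i) - x (σ j)) / 2 + ((d i - d j : ℤ) : ℝ) * Real.pi by ring,
      Real.sin_add_int_mul_pi]
    push_cast
    rw [zpow_sub₀ (by norm_num), div_eq_mul_inv, ← zpow_neg, ← inv_zpow']
    norm_num
  rw [sinProd_eq, sinProd_eq, Finset.prod_congr rfl fun ij _ => hs ij.1 ij.2,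
    Finset.prod_mul_distrib, prod_pairs_mul (fun j => (-1 : ℂ) ^ d j)]
  have : ∏ j, (-1 : ℂ) ^ d j = 1 := by
    have h1 : ∀ s : Finset (Fin N), ∏ j ∈ s, (-1 : ℂ) ^ d j = (-1) ^ ∑ j ∈ s, d j := by
      intro s
      induction s using Finset.induction_on with
      | empty => simp
      | insert a s ha ih =>
        rw [Finset.prod_insert ha, Finset.sum_insert ha, ih, zpow_add₀ (by norm_num)]
    rw [h1, hd, zpow_zero]
  rw [this, one_pow, one_mul]
  refine prod_pairs_comp_sign σ (fun i j => (Real.sin ((x i - x j) / 2) : ℂ)) fun i j => ?_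
  rw [← neg_sub, neg_div, Real.sin_neg, Complex.ofReal_neg]

theorem sign_mul_self (σ : Equiv.Perm (Fin N)) :
    ((Equiv.Perm.sign σ : ℤ) : ℂ) * ((Equiv.Perm.sign σ : ℤ) : ℂ) = 1 := by
  rcases Int.units_eq_one_or (Equiv.Perm.sign σ) with h | h <;> simp [h]

theorem sign_ne_zero (σ : Equiv.Perm (Fin N)) : ((Equiv.Perm.sign σ : ℤ) : ℂ) ≠ 0 :=
  left_ne_zero_of_mul (sign_mul_self σ ▸ one_ne_zero)

theorem symMap_mem_regularSet (σ : Equiv.Perm (Fin N)) {c : Fin N → ℝ} (hc : IsShift c)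
    {x : Fin N → ℝ} (hx : x ∈ regularSet N) : symMap σ c x ∈ regularSet N := by
  rw [← sinProd_ne_zero_iff] at hx ⊢
  rw [sinProd_symMap σ hc]
  exact mul_ne_zero (sign_ne_zero σ) hx

theorem analyticAt_comp_sub {r : ℝ → ℂ} (hr : ∀ z, AnalyticAt ℝ r z) (i j : Fin N)
    (x : Fin N → ℝ) : AnalyticAt ℝ (fun y : Fin N → ℝ => r (y i - y j)) x := by
  let L : (Fin N → ℝ) →L[ℝ] ℝ :=
    ContinuousLinearMap.proj (R := ℝ) (φ := fun _ : Fin N => ℝ) i - ContinuousLinearMap.proj j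
  exact AnalyticAt.fun_comp (f := L) (g := r) (hr _) (L.analyticAt x)

theorem analyticAt_sinProd (x : Fin N → ℝ) : AnalyticAt ℝ (sinProd N) x := by
  have : sinProd N = fun x : Fin N → ℝ => ∏ ij : Fin N × Fin N with ij.1 < ij.2,
      (Real.sin ((x ij.1 - x ij.2) / 2) : ℂ) := funext sinProd_eq
  rw [this]
  refine Finset.analyticAt_fun_prod _ fun ij _ => ?_
  refine analyticAt_comp_sub (r := fun z => (Real.sin (z / 2) : ℂ)) (fun z => ?_) _ _ x
  have h1 : AnalyticAt ℝ (fun z : ℝ => Real.sin (z / 2)) z := by fun_prop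
  exact (Complex.ofRealCLM.analyticAt _).fun_comp h1

/-- An analytic function which is alternating under the affine symmetries is divisible by the
product of sines, and the quotient is invariant. -/
theorem exists_eq_sinProd_mul_of_alternating {G : Fn N} (hG : AnalyticOnNhd ℝ G Set.univ)
    (hs : ∀ σ c, IsShift c → ∀ x, G (symMap σ c x) = ((Equiv.Perm.sign σ : ℤ) : ℂ) * G x) :
    ∃ g : Fn N, AnalyticOnNhd ℝ g Set.univ ∧ ∀ x, G x = sinProd N x * g x := by
  refine exists_eq_sinProd_mul hG fun x a b hab h => ?_
  obtain ⟨m, hm⟩ := Real.sin_eq_zero_iff.1 h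
  have hm' : x a - x b = 2 * Real.pi * m := by linarith
  have hper : ∀ (m : ℤ) y, G (y + (2 * Real.pi * m) • (Pi.single a 1 - Pi.single b 1)) = G y := by
    have h1 : ∀ y, G (y + (2 * Real.pi) • (Pi.single a 1 - Pi.single b 1)) = G y := fun y => by
      simpa [symMap] using! hs 1 _ (Or.inr ⟨a, b, rfl⟩) y
    intro m
    induction m using Int.induction_on with
    | zero => simp
    | succ n ih =>
      intro y
      refine Eq.trans ?_ ((h1 _).trans (ih y))
      congr 1
      push_cast
      module
    | pred n ih =>
      intro y
      refine (h1 _).symm.trans (Eq.trans ?_ (ih y))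
      congr 1
      push_cast
      module
  have hsw := hs (Equiv.swap a b) 0 (Or.inl ⟨0, rfl⟩) x
  have hfix : symMap (Equiv.swap a b) 0 x + (2 * Real.pi * m) • (Pi.single a 1 - Pi.single b 1) = x := by
    funext k
    simp only [symMap, Pi.add_apply, Pi.zero_apply, add_zero, Pi.smul_apply, Pi.sub_apply,
      Pi.single_apply, smul_eq_mul, ← hm']
    by_cases hka : k = a
    · subst hka; simp [hab]
    · by_cases hkb : k = b
      · subst hkb; simp [hka]
      · simp [hka, hkb, Equiv.swap_apply_of_ne_of_ne]
  rw [← hper m, hfix, Equiv.Perm.sign_swap hab] at hsw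
  have : G x = -G x := by simpa using hsw
  exact self_eq_neg.1 this

/-- A criterion for an operator to preserve the invariant analytic functions. -/
theorem preserves_of_local {D : Fn N → Fn N}
    (hloc : ∀ f, IsAnalyticTorusInvariant f → ∀ x₀, ∃ k : Fn N, AnalyticAt ℝ k x₀ ∧
      ∀ᶠ x in 𝓝 x₀, x ∈ regularSet N → D f x = k x)
    (hsym : ∀ f, IsAnalyticTorusInvariant f → ∀ σ c, IsShift c → ∀ x ∈ regularSet N,
      D f (symMap σ c x) = D f x) : Preserves D := by
  intro f hf
  obtain ⟨g, hg, hgD⟩ := exists_analyticOnNhd_of_dense dense_regularSet (D f) (hloc f hf)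
  refine ⟨g, ⟨isAnalyticTorusInvariant_of_symMap hg fun σ c hc => ?_, hgD⟩, ?_⟩
  · refine congrFun (Continuous.ext_on dense_regularSet
      (hg.continuous.comp (continuous_symMap σ c)) hg.continuous fun x hx => ?_)
    rw [hgD x hx, hgD _ (symMap_mem_regularSet σ hc hx), hsym f hf σ c hc x hx]
  · rintro g' ⟨hg', hgD'⟩
    exact Continuous.ext_on dense_regularSet hg'.analytic.continuous hg.continuous
      fun x hx => (hgD' x hx).trans (hgD x hx).symm

end EllipticCM

theorem Complex.mul_cpow_of_re_pos {a b : ℂ} (ha : 0 < a.re) (hb : 0 < b.re) (s : ℂ) :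
    (a * b) ^ s = a ^ s * b ^ s := by
  have ha0 : a ≠ 0 := fun h => by simp [h] at ha
  have hb0 : b ≠ 0 := fun h => by simp [h] at hb
  have h1 := abs_lt.1 (Complex.abs_arg_lt_pi_div_two_iff.2 (Or.inl ha))
  have h2 := abs_lt.1 (Complex.abs_arg_lt_pi_div_two_iff.2 (Or.inl hb))
  rw [Complex.cpow_def_of_ne_zero (mul_ne_zero ha0 hb0), Complex.cpow_def_of_ne_zero ha0,
    Complex.cpow_def_of_ne_zero hb0, Complex.log_mul ha0 hb0
      ⟨by linarith [h1.1, h2.1], by linarith [h1.2, h2.2]⟩, add_mul, Complex.exp_add]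

theorem Complex.div_cpow_neg_of_re_pos {a b : ℂ} (ha : 0 < a.re) (hb : 0 < b.re) (s : ℂ) :
    (a / b) ^ (-s) = b ^ s * a ^ (-s) := by
  have hb0 : b ≠ 0 := fun h => by simp [h] at hb
  have h2 := abs_lt.1 (Complex.abs_arg_lt_pi_div_two_iff.2 (Or.inl hb))
  have hbi : 0 < (b⁻¹).re := by
    rw [Complex.inv_re]
    exact div_pos hb (Complex.normSq_pos.2 hb0)
  rw [div_eq_mul_inv, Complex.mul_cpow_of_re_pos ha hbi, Complex.inv_cpow _ _ (by
    have := Real.pi_pos; intro h; linarith [h2.2]), Complex.cpow_neg b, inv_inv, mul_comm]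

theorem AnalyticAt.eventually_div_re_pos {E : Type*} [NormedAddCommGroup E] [NormedSpace ℝ E]
    {u : E → ℂ} {x : E} (hu : AnalyticAt ℝ u x) (h0 : u x ≠ 0) :
    ∀ᶠ y in 𝓝 x, 0 < (u y / u x).re := by
  have h : ContinuousAt (fun y => (u y / u x).re) x :=
    Complex.continuous_re.continuousAt.comp (hu.continuousAt.div_const _)
  refine h.eventually (lt_mem_nhds ?_)
  simp [h0]

theorem AnalyticAt.div_cpow_const {E : Type*} [NormedAddCommGroup E] [NormedSpace ℝ E]
    {u : E → ℂ} {x : E} (hu : AnalyticAt ℝ u x) (h0 : u x ≠ 0) (s : ℂ) :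
    AnalyticAt ℝ (fun y => (u y / u x) ^ s) x := by
  have h1 : AnalyticAt ℂ (fun w : ℂ => w ^ s) (u x / u x) := by
    refine analyticAt_id.cpow analyticAt_const ?_
    simp [h0]
  exact AnalyticAt.fun_comp (g := fun w : ℂ => w ^ s) (f := fun y => u y / u x)
    h1.restrictScalars hu.div_const

namespace EllipticCM

variable {N : ℕ}

/-! ### The gauge-transformed Hasegawa operators -/

theorem prodPartialD_eq_iter (J : Finset (Fin N)) (f : Fn N) :
    prodPartialD J f = iterPartialD J.sort f := rfl

/-- The regular factor of the theta product. -/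
noncomputable def pairFactor (r : ℝ → ℂ) : Fn N :=
  fun x => ∏ ij : Fin N × Fin N with ij.1 < ij.2, r (x ij.1 - x ij.2)

theorem analyticAt_pairFactor {r : ℝ → ℂ} (hr : ∀ z, AnalyticAt ℝ r z) (x : Fin N → ℝ) :
    AnalyticAt ℝ (pairFactor r) x :=
  Finset.analyticAt_fun_prod _ fun _ _ => analyticAt_comp_sub hr _ _ x

theorem pairFactor_ne_zero {r : ℝ → ℂ} (hr : ∀ z, r z ≠ 0) (x : Fin N → ℝ) :
    pairFactor r x ≠ 0 :=
  Finset.prod_ne_zero_iff.2 fun _ _ => hr _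

theorem pairFactor_symMap {r : ℝ → ℂ} (he : ∀ z, r (-z) = r z)
    (hp : Function.Periodic r (2 * Real.pi)) (σ : Equiv.Perm (Fin N)) {c : Fin N → ℝ}
    (hc : IsShift c) (x : Fin N → ℝ) : pairFactor r (symMap σ c x) = pairFactor r x := by
  obtain ⟨d, -, h⟩ := exists_int_symMap_sub hc
  have h1 : ∀ i j, r (symMap σ c x i - symMap σ c x j) = r (x (σ i) - x (σ j)) := fun i j => by
    rw [h, mul_comm]
    exact hp.int_mul _ _
  simp only [pairFactor, h1]
  exact prod_pairs_comp σ (fun i j => r (x i - x j)) fun i j => by rw [← neg_sub, he]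

theorem bigTheta_eq {θ : ℂ → ℂ} {r : ℝ → ℂ}
    (hθ : ∀ z : ℝ, θ ((z : ℂ) / (2 * Real.pi)) = r z * (Real.sin (z / 2) : ℂ)) (x : Fin N → ℝ) :
    bigTheta θ x = pairFactor r x * sinProd N x := by
  rw [sinProd_eq, pairFactor, ← Finset.prod_mul_distrib]
  exact Finset.prod_congr rfl fun ij _ => hθ _

/-- The local branch of `R^{-β} f` near `x`. -/
noncomputable def twist (R : Fn N) (β : ℂ) (f : Fn N) (x : Fin N → ℝ) : Fn N :=
  fun y => (R y / R x) ^ (-β) * f y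

theorem analyticAt_twist {R f : Fn N} {x : Fin N → ℝ} (hR : AnalyticAt ℝ R x) (h0 : R x ≠ 0)
    (β : ℂ) (hf : AnalyticAt ℝ f x) : AnalyticAt ℝ (twist R β f x) x :=
  (hR.div_cpow_const h0 _).fun_mul hf

theorem analyticAt_iterPartialD_twist {R f : Fn N} {x₀ : Fin N → ℝ} (hR : AnalyticAt ℝ R x₀)
    (h0 : R x₀ ≠ 0) (β : ℂ) (hf : AnalyticAt ℝ f x₀) (l : List (Fin N)) :
    AnalyticAt ℝ (fun x => iterPartialD l (twist R β f x) x) x₀ := by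
  have h1 : AnalyticAt ℝ (fun x => (R x / R x₀) ^ β * iterPartialD l (twist R β f x₀) x) x₀ :=
    (hR.div_cpow_const h0 _).fun_mul ((analyticAt_twist hR h0 β hf).iterPartialD l)
  refine h1.congr ?_
  filter_upwards [(hR.eventually_div_re_pos h0).eventually_nhds,
    hR.continuousAt.eventually_ne h0] with x hx hx0
  have h2 : twist R β f x =ᶠ[𝓝 x] fun y => (R x / R x₀) ^ β * twist R β f x₀ y := by
    filter_upwards [hx] with y hy
    have : R y / R x = R y / R x₀ / (R x / R x₀) := by field_simp
    simp only [twist]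
    rw [this, Complex.div_cpow_neg_of_re_pos hy hx.self_of_nhds]
    ring
  rw [(h2.iterPartialD l).eq_of_nhds, iterPartialD_const_mul]

/-- `Θ` times Hasegawa's operator, applied to the local branches of `R^{-β} f`. -/
noncomputable def hasegawaNumerator (β : ℂ) (Θ R : Fn N) (i : ℕ) (f : Fn N) : Fn N :=
  fun x => ∑ I ∈ (Finset.univ : Finset (Fin N)).powersetCard i, ∑ J ∈ I.powerset,
    β ^ J.card * prodPartialD J Θ x * prodPartialD (I \ J) (twist R β f x) x

theorem analyticAt_hasegawaNumerator {Θ R f : Fn N} {x : Fin N → ℝ} (hΘ : AnalyticAt ℝ Θ x)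
    (hR : AnalyticAt ℝ R x) (h0 : R x ≠ 0) (hf : AnalyticAt ℝ f x) (β : ℂ) (i : ℕ) :
    AnalyticAt ℝ (hasegawaNumerator β Θ R i f) x := by
  unfold hasegawaNumerator
  refine Finset.analyticAt_fun_sum _ fun I _ => Finset.analyticAt_fun_sum _ fun J _ => ?_
  simp only [prodPartialD_eq_iter]
  have h1 := hΘ.iterPartialD J.sort
  have h2 := analyticAt_iterPartialD_twist hR h0 β hf (I \ J).sort
  exact (analyticAt_const.fun_mul h1).fun_mul h2

theorem hasegawaNumerator_symMap {Θ R f : Fn N} (hΘ : ∀ x, AnalyticAt ℝ Θ x)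
    (hR : ∀ x, AnalyticAt ℝ R x) (h0 : ∀ x, R x ≠ 0) (hf : ∀ x, AnalyticAt ℝ f x) (β : ℂ) (i : ℕ)
    (σ : Equiv.Perm (Fin N)) (c : Fin N → ℝ) (ε : ℂ)
    (hΘs : ∀ x, Θ (symMap σ c x) = ε * Θ x) (hRs : ∀ x, R (symMap σ c x) = R x)
    (hfs : ∀ x, f (symMap σ c x) = f x) (x : Fin N → ℝ) :
    hasegawaNumerator β Θ R i f (symMap σ c x) = ε * hasegawaNumerator β Θ R i f x := by
  have h1 : ∀ J : Finset (Fin N), prodPartialD (J.map σ.symm.toEmbedding) Θ (symMap σ c x) =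
      ε * prodPartialD J Θ x := by
    intro J
    rw [← prodPartialD_comp_symMap σ c (hΘ _), funext hΘs]
    exact congrFun (iterPartialD_const_mul ε Θ J.sort) x
  have h2 : ∀ J : Finset (Fin N), prodPartialD (J.map σ.symm.toEmbedding)
      (twist R β f (symMap σ c x)) (symMap σ c x) = prodPartialD J (twist R β f x) x := by
    intro J
    rw [← prodPartialD_comp_symMap σ c (analyticAt_twist (hR _) (h0 _) β (hf _))]
    simp only [twist, hRs, hfs]
    rfl
  have hmap : ∀ I J : Finset (Fin N), I.map σ.symm.toEmbedding \ J.map σ.symm.toEmbedding =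
      (I \ J).map σ.symm.toEmbedding := fun I J => by
    ext; simp
  simp only [hasegawaNumerator, Finset.mul_sum]
  symm
  refine Finset.sum_equiv σ.symm.finsetCongr (by simp) fun I _ => ?_
  refine Finset.sum_equiv σ.symm.finsetCongr (by simp) fun J _ => ?_
  simp only [Equiv.finsetCongr_apply, Finset.card_map, hmap, h1, h2]
  ring

theorem gaugedHasegawa_eq {θ : ℂ → ℂ} {r : ℝ → ℂ} (hr : ∀ z, AnalyticAt ℝ r z)
    (hr0 : ∀ z, r z ≠ 0)
    (hθ : ∀ z : ℝ, θ ((z : ℂ) / (2 * Real.pi)) = r z * (Real.sin (z / 2) : ℂ)) (β : ℂ) (i : ℕ)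
    (f : Fn N) {x : Fin N → ℝ} (hx : x ∈ regularSet N) :
    gaugedHasegawa N β θ i f x =
      hasegawaNumerator β (bigTheta θ) (pairFactor r) i f x / bigTheta θ x := by
  have hS := sinProd_ne_zero_iff.2 hx
  have hR := pairFactor_ne_zero hr0 x
  have key : (fun y => (bigTheta θ y / bigTheta θ x) ^ (-β) *
      ((sinProd N y / sinProd N x) ^ β * f y)) =ᶠ[𝓝 x] twist (pairFactor r) β f x := by
    filter_upwards [(analyticAt_sinProd x).eventually_div_re_pos hS,
      (analyticAt_pairFactor hr x).eventually_div_re_pos hR] with y h1 h2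
    have h3 : bigTheta θ y / bigTheta θ x =
        (pairFactor r y / pairFactor r x) * (sinProd N y / sinProd N x) := by
      rw [bigTheta_eq hθ, bigTheta_eq hθ]; field_simp
    have h4 : (sinProd N y / sinProd N x) ^ β ≠ 0 := by
      rw [Ne, Complex.cpow_eq_zero_iff, not_and_or]
      exact Or.inl fun h => by simp [h] at h1
    rw [h3, Complex.mul_cpow_of_re_pos h2 h1, Complex.cpow_neg (sinProd N y / sinProd N x), twist]
    field_simp
  simp only [gaugedHasegawa, hasegawa, conjPow, hasegawaHat, hasegawaNumerator, Finset.sum_div]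
  refine Finset.sum_congr rfl fun I _ => Finset.sum_congr rfl fun J _ => ?_
  rw [prodPartialD_eq_iter (I \ J), (key.iterPartialD _).eq_of_nhds, ← prodPartialD_eq_iter]
  ring

/-- The gauge-transformed Hasegawa operators preserve the invariant analytic functions as soon as
the theta function is `sin` times a nonvanishing even periodic analytic function. -/
theorem preserves_gaugedHasegawa {θ : ℂ → ℂ} {r : ℝ → ℂ} (hr : ∀ z, AnalyticAt ℝ r z)
    (hr0 : ∀ z, r z ≠ 0) (he : ∀ z, r (-z) = r z) (hp : Function.Periodic r (2 * Real.pi))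
    (hθ : ∀ z : ℝ, θ ((z : ℂ) / (2 * Real.pi)) = r z * (Real.sin (z / 2) : ℂ)) (β : ℂ) (i : ℕ) :
    Preserves (gaugedHasegawa N β θ i) := by
  have hΘs : ∀ σ c, IsShift c → ∀ x : Fin N → ℝ, bigTheta θ (symMap σ c x) =
      ((Equiv.Perm.sign σ : ℤ) : ℂ) * bigTheta θ x := fun σ c hc x => by
    rw [bigTheta_eq hθ, bigTheta_eq hθ, pairFactor_symMap he hp σ hc, sinProd_symMap σ hc]
    ring
  have hΘ : ∀ x : Fin N → ℝ, AnalyticAt ℝ (bigTheta θ) x := fun x => by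
    rw [show (bigTheta θ : Fn N) = fun x => _ from funext (bigTheta_eq hθ)]
    exact (analyticAt_pairFactor hr x).fun_mul (analyticAt_sinProd x)
  have hR := fun x : Fin N → ℝ => analyticAt_pairFactor hr x
  have hR0 := fun x : Fin N → ℝ => pairFactor_ne_zero hr0 x
  have halt : ∀ f : Fn N, IsAnalyticTorusInvariant f → ∀ σ c, IsShift c → ∀ x,
      hasegawaNumerator β (bigTheta θ) (pairFactor r) i f (symMap σ c x) =
      ((Equiv.Perm.sign σ : ℤ) : ℂ) * hasegawaNumerator β (bigTheta θ) (pairFactor r) i f x :=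
    fun f hf σ c hc x => hasegawaNumerator_symMap hΘ hR hR0 (fun x => hf.analytic x trivial) β i σ c
      _ (hΘs σ c hc) (pairFactor_symMap he hp σ hc) (hf.comp_symMap σ hc) x
  refine preserves_of_local (fun f hf x₀ => ?_) fun f hf σ c hc x hx => ?_
  · obtain ⟨g, hg, hGg⟩ := exists_eq_sinProd_mul_of_alternating (fun x _ =>
      analyticAt_hasegawaNumerator (hΘ x) (hR x) (hR0 x) (hf.analytic x trivial) β i) (halt f hf)
    refine ⟨fun x => g x / pairFactor r x, (hg x₀ trivial).fun_div (hR x₀) (hR0 x₀),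
      Eventually.of_forall fun x hx => ?_⟩
    rw [gaugedHasegawa_eq hr hr0 hθ β i f hx, hGg, bigTheta_eq hθ]
    have := sinProd_ne_zero_iff.2 hx
    have := hR0 x
    field_simp
  · rw [gaugedHasegawa_eq hr hr0 hθ β i f hx,
      gaugedHasegawa_eq hr hr0 hθ β i f (symMap_mem_regularSet σ hc hx), halt f hf σ c hc,
      hΘs σ c hc, mul_div_mul_left _ _ (sign_ne_zero σ)]

/-! ### The gauge-transformed Hamiltonian -/

/-- Second derivative along a coordinate of a local branch of a power, times a function. -/
theorem partialD_partialD_cpow_mul {u f : Fn N} {x : Fin N → ℝ} (hu : AnalyticAt ℝ u x)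
    (h0 : u x ≠ 0) (hf : AnalyticAt ℝ f x) (β : ℂ) (i : Fin N) :
    partialD i (partialD i fun y => (u y / u x) ^ β * f y) x =
      (β ^ 2 * (partialD i u x / u x) ^ 2 + β * partialD i (fun y => partialD i u y / u y) x) * f x +
        2 * β * (partialD i u x / u x) * partialD i f x + partialD i (partialD i f) x := by
  have hv := hu.div_cpow_const h0 β
  have hL : AnalyticAt ℝ (fun y => partialD i u y / u y) x := (hu.partialD i).fun_div hu h0
  have hdv : partialD i (fun y => (u y / u x) ^ β) =ᶠ[𝓝 x]
      fun y => (u y / u x) ^ β * (β * (partialD i u y / u y)) := by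
    filter_upwards [hu.eventually_div_re_pos h0, hu.eventually_analyticAt,
      hu.continuousAt.eventually_ne h0] with y hy hya hy0
    have h1 : HasLineDerivAt ℝ u (partialD i u y) y (Pi.single i 1) :=
      hya.differentiableAt.lineDifferentiableAt.hasLineDerivAt
    have h2 : HasDerivAt (fun t : ℝ => (u (y + t • Pi.single i 1) / u x))
        (partialD i u y / u x) 0 := HasDerivAt.div_const h1 _
    have h3 : HasDerivAt (fun w : ℂ => w ^ β) (β * (u y / u x) ^ (β - 1) * 1) (u y / u x) :=
      (hasDerivAt_id _).cpow_const (Or.inl hy)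
    have h4 : HasDerivAt (fun t : ℝ => (u (y + t • Pi.single i 1) / u x) ^ β)
        ((partialD i u y / u x) • (β * (u y / u x) ^ (β - 1) * 1)) 0 := by
      refine HasDerivAt.scomp (0 : ℝ) (g₁ := fun w : ℂ => w ^ β) ?_ h2
      simpa using h3
    have h5 : partialD i (fun y => (u y / u x) ^ β) y = _ := h4.deriv
    rw [h5, Complex.cpow_sub _ _ (div_ne_zero hy0 h0), Complex.cpow_one, smul_eq_mul]
    field_simp
  have h1 : partialD i (fun y => (u y / u x) ^ β * f y) =ᶠ[𝓝 x]
      fun y => (u y / u x) ^ β * (β * (partialD i u y / u y)) * f y +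
        (u y / u x) ^ β * partialD i f y := by
    filter_upwards [hdv, hv.eventually_analyticAt, hf.eventually_analyticAt] with y h1 h2 h3
    rw [partialD_mul h2 h3, h1]
  have hβL : AnalyticAt ℝ (fun y => β * (partialD i u y / u y)) x := analyticAt_const.fun_mul hL
  have hx1 : (u x / u x) ^ β = 1 := by rw [div_self h0, Complex.one_cpow]
  rw [(h1.partialD i).eq_of_nhds, partialD_add ((hv.fun_mul hβL).fun_mul hf)
    (hv.fun_mul (hf.partialD i)), partialD_mul (hv.fun_mul hβL) hf, partialD_mul hv hβL,
    partialD_mul hv (hf.partialD i), hdv.eq_of_nhds, partialD_const_mul, hx1]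
  ring

theorem partialD_div_add_sq {u : Fn N} {x : Fin N → ℝ} (hu : AnalyticAt ℝ u x)
    (h0 : u x ≠ 0) (i : Fin N) :
    partialD i (fun y => partialD i u y / u y) x + (partialD i u x / u x) ^ 2 =
      partialD i (partialD i u) x / u x := by
  have hL : AnalyticAt ℝ (fun y => partialD i u y / u y) x := (hu.partialD i).fun_div hu h0
  have h : partialD i u =ᶠ[𝓝 x] fun y => (partialD i u y / u y) * u y := by
    filter_upwards [hu.continuousAt.eventually_ne h0] with y hy
    field_simp
  rw [(h.partialD i).eq_of_nhds, partialD_mul hL hu]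
  field_simp

theorem partialD_sinProd_div {x : Fin N → ℝ} (hx : x ∈ regularSet N) (i : Fin N) :
    partialD i (sinProd N) x / sinProd N x =
      ∑ ab : Fin N × Fin N with ab.1 < ab.2, ((((Pi.single i 1 : Fin N → ℝ) ab.1 -
        (Pi.single i 1 : Fin N → ℝ) ab.2) / 2 * (Real.cos ((x ab.1 - x ab.2) / 2) /
          Real.sin ((x ab.1 - x ab.2) / 2)) : ℝ) : ℂ) := by
  have hne : ∀ ab ∈ Finset.univ.filter (fun ab : Fin N × Fin N => ab.1 < ab.2),
      Real.sin ((x ab.1 - x ab.2) / 2) ≠ 0 := fun ab hab =>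
    mem_regularSet_iff.1 hx _ _ (by simpa using hab : ab.1 < ab.2).ne
  have h1 : ∀ t : ℝ, sinProd N (x + t • Pi.single i 1) =
      ∏ ab : Fin N × Fin N with ab.1 < ab.2, (Real.sin ((x ab.1 - x ab.2 + t *
        ((Pi.single i 1 : Fin N → ℝ) ab.1 - (Pi.single i 1 : Fin N → ℝ) ab.2)) / 2) : ℂ) := by
    intro t
    rw [sinProd_eq]
    refine Finset.prod_congr rfl fun ab _ => ?_
    simp only [Pi.add_apply, Pi.smul_apply, smul_eq_mul]
    congr 3
    ring
  have hd : ∀ ab : Fin N × Fin N, HasDerivAt (fun t : ℝ => (Real.sin ((x ab.1 - x ab.2 + t *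
        ((Pi.single i 1 : Fin N → ℝ) ab.1 - (Pi.single i 1 : Fin N → ℝ) ab.2)) / 2) : ℂ))
      ((Real.cos ((x ab.1 - x ab.2) / 2) * (((Pi.single i 1 : Fin N → ℝ) ab.1 -
        (Pi.single i 1 : Fin N → ℝ) ab.2) / 2) : ℝ) : ℂ) 0 := by
    intro ab
    have := ((((hasDerivAt_id (0 : ℝ)).mul_const ((Pi.single i 1 : Fin N → ℝ) ab.1 -
      (Pi.single i 1 : Fin N → ℝ) ab.2)).const_add (x ab.1 - x ab.2)).div_const 2).sin.ofReal_comp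
    simpa using this
  have h2 : partialD i (sinProd N) x / sinProd N x = logDeriv (fun t : ℝ =>
      ∏ ab : Fin N × Fin N with ab.1 < ab.2, (Real.sin ((x ab.1 - x ab.2 + t *
        ((Pi.single i 1 : Fin N → ℝ) ab.1 - (Pi.single i 1 : Fin N → ℝ) ab.2)) / 2) : ℂ)) 0 := by
    rw [logDeriv_apply, ← h1 0, zero_smul, add_zero]
    simp only [partialD, lineDeriv, h1]
  rw [h2, logDeriv_prod (fun ab hab => by
      rw [zero_mul, add_zero]; exact Complex.ofReal_ne_zero.2 (hne ab hab))
    fun ab _ => (hd ab).differentiableAt]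
  refine Finset.sum_congr rfl fun ab hab => ?_
  rw [logDeriv_apply, (hd ab).deriv, zero_mul, add_zero]
  push_cast
  ring

theorem sum_partialD_partialD_sinProd_div {x : Fin N → ℝ} (hx : x ∈ regularSet N) :
    ∑ i, partialD i (fun y => partialD i (sinProd N) y / sinProd N y) x =
      -∑ ab : Fin N × Fin N with ab.1 < ab.2,
        1 / (2 * (Real.sin ((x ab.1 - x ab.2) / 2) : ℂ) ^ 2) := by
  have hev : ∀ᶠ y in 𝓝 x, y ∈ regularSet N := by
    filter_upwards [(analyticAt_sinProd x).continuousAt.eventually_ne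
      (sinProd_ne_zero_iff.2 hx)] with y hy using sinProd_ne_zero_iff.1 hy
  have h1 : ∀ i, partialD i (fun y => partialD i (sinProd N) y / sinProd N y) x =
      ∑ ab : Fin N × Fin N with ab.1 < ab.2, ((-(((Pi.single i 1 : Fin N → ℝ) ab.1 -
        (Pi.single i 1 : Fin N → ℝ) ab.2) ^ 2) / 4 * (1 /
          Real.sin ((x ab.1 - x ab.2) / 2) ^ 2) : ℝ) : ℂ) := by
    intro i
    have h2 : (fun y => partialD i (sinProd N) y / sinProd N y) =ᶠ[𝓝 x] _ :=
      hev.mono fun y hy => partialD_sinProd_div hy i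
    rw [(h2.partialD i).eq_of_nhds]
    refine HasDerivAt.deriv (HasDerivAt.fun_sum fun ab hab => ?_)
    have hs : Real.sin ((x ab.1 - x ab.2) / 2) ≠ 0 :=
      mem_regularSet_iff.1 hx _ _ (by simpa using hab : ab.1 < ab.2).ne
    set d := (Pi.single i 1 : Fin N → ℝ) ab.1 - (Pi.single i 1 : Fin N → ℝ) ab.2 with hd
    have h3 : HasDerivAt (fun t : ℝ => ((x + t • (Pi.single i 1 : Fin N → ℝ)) ab.1 -
        (x + t • (Pi.single i 1 : Fin N → ℝ)) ab.2) / 2) (d / 2) 0 := by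
      have := (((hasDerivAt_id (0 : ℝ)).mul_const d).const_add (x ab.1 - x ab.2)).div_const 2
      convert! this using 1
      · funext t
        simp [hd]
        ring
      · simp
    have h4 := ((h3.cos.fun_div h3.sin (by simpa using hs)).const_mul (d / 2)).ofReal_comp
    convert! h4 using 2
    simp only [zero_smul, add_zero]
    have h5 := Real.sin_sq_add_cos_sq ((x ab.1 - x ab.2) / 2)
    rw [← h5]
    field_simp
    ring
  simp only [h1]
  rw [Finset.sum_comm, ← Finset.sum_neg_distrib]
  refine Finset.sum_congr rfl fun ab hab => ?_
  have hab' : ab.1 ≠ ab.2 := (by simpa using hab : ab.1 < ab.2).ne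
  rw [← Complex.ofReal_sum, ← Finset.sum_mul, ← Finset.sum_div, Finset.sum_neg_distrib]
  have h6 : ∑ i, ((Pi.single i 1 : Fin N → ℝ) ab.1 - (Pi.single i 1 : Fin N → ℝ) ab.2) ^ 2 = 2 := by
    have : ∀ i, ((Pi.single i 1 : Fin N → ℝ) ab.1 - (Pi.single i 1 : Fin N → ℝ) ab.2) ^ 2 =
        (if ab.1 = i then 1 else 0) + (if ab.2 = i then 1 else 0) := by
      intro i
      simp only [Pi.single_apply]
      split_ifs with h7 h8
      · exact absurd (h7.trans h8.symm) hab'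
      all_goals norm_num
    simp only [this, Finset.sum_add_distrib, Finset.sum_ite_eq, Finset.mem_univ, if_true]
    norm_num
  rw [h6]
  push_cast
  ring

/-- Explicit form of the gauge-transformed Hamiltonian. -/
theorem gaugedHamiltonian_eq (β : ℂ) (P : ℂ → ℂ) {f : Fn N} {x : Fin N → ℝ}
    (hf : AnalyticAt ℝ f x) (hx : x ∈ regularSet N) :
    gaugedHamiltonian N β P f x =
      -(1 / 2) * ∑ i, partialD i (partialD i f) x -
      β * ((∑ i, partialD i (sinProd N) x * partialD i f x) / sinProd N x) -
      1 / 2 * β ^ 2 * ((∑ i, partialD i (partialD i (sinProd N)) x) / sinProd N x) * f x +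
      β * (β - 1) * (∑ ij : Fin N × Fin N with ij.1 < ij.2, (P ((x ij.1 - x ij.2 : ℝ) : ℂ) -
        1 / (4 * (Real.sin ((x ij.1 - x ij.2) / 2) : ℂ) ^ 2))) * f x := by
  have hS := analyticAt_sinProd x
  have h0 := sinProd_ne_zero_iff.2 hx
  have e1 := sum_partialD_partialD_sinProd_div hx
  have e2 : ∑ i, (partialD i (sinProd N) x / sinProd N x) ^ 2 =
      (∑ i, partialD i (partialD i (sinProd N)) x) / sinProd N x -
        ∑ i, partialD i (fun y => partialD i (sinProd N) y / sinProd N y) x := by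
    rw [Finset.sum_div, ← Finset.sum_sub_distrib]
    exact Finset.sum_congr rfl fun i _ => by rw [← partialD_div_add_sq hS h0]; ring
  have e3 : ∑ i, partialD i (partialD i fun y => (sinProd N y / sinProd N x) ^ β * f y) x =
      (β ^ 2 * ∑ i, (partialD i (sinProd N) x / sinProd N x) ^ 2 +
        β * ∑ i, partialD i (fun y => partialD i (sinProd N) y / sinProd N y) x) * f x +
      2 * β * ((∑ i, partialD i (sinProd N) x * partialD i f x) / sinProd N x) +
      ∑ i, partialD i (partialD i f) x := by
    simp only [partialD_partialD_cpow_mul hS h0 hf, Finset.sum_add_distrib, Finset.mul_sum,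
      Finset.sum_mul, Finset.sum_div, add_mul]
    congr 2
    refine Finset.sum_congr rfl fun i _ => by ring
  have e4 : ∑ ij : Fin N × Fin N with ij.1 < ij.2,
      1 / (2 * (Real.sin ((x ij.1 - x ij.2) / 2) : ℂ) ^ 2) =
      2 * ∑ ij : Fin N × Fin N with ij.1 < ij.2,
        1 / (4 * (Real.sin ((x ij.1 - x ij.2) / 2) : ℂ) ^ 2) := by
    rw [Finset.mul_sum]
    exact Finset.sum_congr rfl fun _ _ => by ring
  rw [e4] at e1
  simp only [gaugedHamiltonian, conjPow, hamiltonian]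
  rw [e3, e2, e1, Finset.sum_sub_distrib, div_self h0, Complex.one_cpow]
  ring

/-- The gauge-transformed Hamiltonian preserves the invariant analytic functions as soon as the
potential is even, periodic, and differs from `1 / (4 sin² (x / 2))` by an analytic function. -/
theorem preserves_gaugedHamiltonian {P : ℂ → ℂ} (he : ∀ z : ℝ, P ((-z : ℝ) : ℂ) = P z)
    (hp : Function.Periodic (fun z : ℝ => P z) (2 * Real.pi))
    (hP : ∀ z₀ : ℝ, ∃ k : ℝ → ℂ, AnalyticAt ℝ k z₀ ∧ ∀ᶠ z in 𝓝 z₀, Real.sin (z / 2) ≠ 0 →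
      P z - 1 / (4 * (Real.sin (z / 2) : ℂ) ^ 2) = k z) (β : ℂ) :
    Preserves (gaugedHamiltonian N β P) := by
  have hS : ∀ x : Fin N → ℝ, AnalyticAt ℝ (sinProd N) x := analyticAt_sinProd
  have s1 : ∀ (f : Fn N) (ε : ℂ) (σ : Equiv.Perm (Fin N)) (c : Fin N → ℝ),
      (∀ x, f (symMap σ c x) = ε * f x) →
      ∀ i x, partialD (σ.symm i) f (symMap σ c x) = ε * partialD i f x := by
    intro f ε σ c h i x
    rw [← congrFun (partialD_comp_symMap σ c f i) x, funext h, partialD_const_mul]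
  have s2 : ∀ (f : Fn N) (ε : ℂ) (σ : Equiv.Perm (Fin N)) (c : Fin N → ℝ),
      (∀ x, f (symMap σ c x) = ε * f x) →
      ∀ x, ∑ i, partialD i (partialD i f) (symMap σ c x) =
        ε * ∑ i, partialD i (partialD i f) x := by
    intro f ε σ c h x
    rw [← Equiv.sum_comp σ.symm, Finset.mul_sum]
    refine Finset.sum_congr rfl fun i _ => ?_
    rw [← congrFun (partialD_comp_symMap σ c _ i) x, funext (s1 f ε σ c h i), partialD_const_mul]
  have hF : ∀ f : Fn N, IsAnalyticTorusInvariant f → ∀ σ c, IsShift c → ∀ x,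
      f (symMap σ c x) = 1 * f x := fun f hf σ c hc x => by rw [hf.comp_symMap σ hc, one_mul]
  have s3 : ∀ f : Fn N, IsAnalyticTorusInvariant f → ∀ σ c, IsShift c → ∀ x,
      ∑ i, partialD i (sinProd N) (symMap σ c x) * partialD i f (symMap σ c x) =
        ((Equiv.Perm.sign σ : ℤ) : ℂ) * ∑ i, partialD i (sinProd N) x * partialD i f x := by
    intro f hf σ c hc x
    rw [← Equiv.sum_comp σ.symm, Finset.mul_sum]
    refine Finset.sum_congr rfl fun i _ => ?_
    rw [s1 f 1 σ c (hF f hf σ c hc), s1 _ _ σ c (sinProd_symMap σ hc)]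
    ring
  have s4 : ∀ σ (c : Fin N → ℝ), IsShift c → ∀ x,
      ∑ i, partialD i (partialD i (sinProd N)) (symMap σ c x) =
        ((Equiv.Perm.sign σ : ℤ) : ℂ) * ∑ i, partialD i (partialD i (sinProd N)) x :=
    fun σ c hc => s2 _ _ σ c (sinProd_symMap σ hc)
  let Q : ℝ → ℂ := fun z => P z - 1 / (4 * (Real.sin (z / 2) : ℂ) ^ 2)
  have hQe : ∀ z, Q (-z) = Q z := fun z => by
    change P ((-z : ℝ) : ℂ) - 1 / (4 * (Real.sin (-z / 2) : ℂ) ^ 2) = _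
    rw [he, neg_div, Real.sin_neg, Complex.ofReal_neg, neg_sq]
  have hQp : Function.Periodic Q (2 * Real.pi) := fun z => by
    have h1 : P ((z + 2 * Real.pi : ℝ) : ℂ) = P z := hp z
    have h2 : (z + 2 * Real.pi) / 2 = z / 2 + Real.pi := by ring
    simp only [Q, h1, h2, Real.sin_add_pi, Complex.ofReal_neg, neg_sq]
  refine preserves_of_local (fun f hf x₀ => ?_) fun f hf σ c hc x hx => ?_
  · have hfa : ∀ x, AnalyticAt ℝ f x := fun x => hf.analytic x trivial
    obtain ⟨g₁, hg₁, h₁⟩ := exists_eq_sinProd_mul_of_alternating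
      (G := fun x => ∑ i, partialD i (sinProd N) x * partialD i f x)
      (fun x _ => Finset.analyticAt_fun_sum _ fun i _ =>
        ((hS x).partialD i).fun_mul ((hfa x).partialD i)) (s3 f hf)
    obtain ⟨g₂, hg₂, h₂⟩ := exists_eq_sinProd_mul_of_alternating
      (G := fun x => ∑ i, partialD i (partialD i (sinProd N)) x)
      (fun x _ => Finset.analyticAt_fun_sum _ fun i _ => ((hS x).partialD i).partialD i) s4
    have hQl : ∀ ij : Fin N × Fin N, ∃ k : Fn N, AnalyticAt ℝ k x₀ ∧ ∀ᶠ x in 𝓝 x₀,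
        Real.sin ((x ij.1 - x ij.2) / 2) ≠ 0 → Q (x ij.1 - x ij.2) = k x := by
      intro ij
      obtain ⟨k, hk, hQk⟩ := hP (x₀ ij.1 - x₀ ij.2)
      let L : (Fin N → ℝ) →L[ℝ] ℝ := ContinuousLinearMap.proj (R := ℝ)
        (φ := fun _ : Fin N => ℝ) ij.1 - ContinuousLinearMap.proj ij.2
      refine ⟨fun x => k (L x), AnalyticAt.fun_comp (f := L) (g := k) hk (L.analyticAt x₀), ?_⟩
      have hL : Tendsto L (𝓝 x₀) (𝓝 (x₀ ij.1 - x₀ ij.2)) := L.continuous.tendsto x₀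
      exact hL.eventually hQk
    choose k hk hQk using hQl
    refine ⟨fun x => -(1 / 2) * ∑ i, partialD i (partialD i f) x - β * g₁ x -
      1 / 2 * β ^ 2 * g₂ x * f x +
      β * (β - 1) * (∑ ij : Fin N × Fin N with ij.1 < ij.2, k ij x) * f x, ?_, ?_⟩
    · have a1 : AnalyticAt ℝ (fun x => ∑ i, partialD i (partialD i f) x) x₀ :=
        Finset.analyticAt_fun_sum _ fun i _ => ((hfa x₀).partialD i).partialD i
      have a2 : AnalyticAt ℝ (fun x => ∑ ij : Fin N × Fin N with ij.1 < ij.2, k ij x) x₀ :=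
        Finset.analyticAt_fun_sum _ fun ij _ => hk ij
      have a3 := hg₁ x₀ trivial
      have a4 := hg₂ x₀ trivial
      have a5 := hfa x₀
      exact (((analyticAt_const.fun_mul a1).fun_sub (analyticAt_const.fun_mul a3)).fun_sub
        ((analyticAt_const.fun_mul a4).fun_mul a5)).fun_add
          ((analyticAt_const.fun_mul a2).fun_mul a5)
    · filter_upwards [eventually_all.2 hQk] with x hxk hx
      have h0 := sinProd_ne_zero_iff.2 hx
      have h3 : ∑ ij : Fin N × Fin N with ij.1 < ij.2, (P ((x ij.1 - x ij.2 : ℝ) : ℂ) -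
          1 / (4 * (Real.sin ((x ij.1 - x ij.2) / 2) : ℂ) ^ 2)) =
          ∑ ij : Fin N × Fin N with ij.1 < ij.2, k ij x :=
        Finset.sum_congr rfl fun ij hij => hxk ij (mem_regularSet_iff.1 hx _ _
          (by simpa using hij : ij.1 < ij.2).ne)
      rw [gaugedHamiltonian_eq β P (hfa x) hx, h3, h₁, h₂, mul_div_cancel_left₀ _ h0,
        mul_div_cancel_left₀ _ h0]
  · obtain ⟨d, -, hd⟩ := exists_int_symMap_sub hc
    have h3 : ∑ ij : Fin N × Fin N with ij.1 < ij.2, Q (symMap σ c x ij.1 - symMap σ c x ij.2) =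
        ∑ ij : Fin N × Fin N with ij.1 < ij.2, Q (x ij.1 - x ij.2) := by
      have h1 : ∀ i j, Q (symMap σ c x i - symMap σ c x j) = Q (x (σ i) - x (σ j)) :=
        fun i j => by
          rw [hd, mul_comm]
          exact hQp.int_mul _ _
      simp only [h1]
      exact sum_pairs_comp σ (fun i j => Q (x i - x j)) fun i j => by rw [← neg_sub, hQe]
    simp only [Q] at h3
    rw [gaugedHamiltonian_eq β P (hf.analytic x trivial) hx, gaugedHamiltonian_eq β P
      (hf.analytic _ trivial) (symMap_mem_regularSet σ hc hx), s3 f hf σ c hc, s4 σ c hc,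
      sinProd_symMap σ hc, s2 f 1 σ c (hF f hf σ c hc), one_mul, hf.comp_symMap σ hc, h3]
    have hσ := sign_ne_zero σ
    generalize ((Equiv.Perm.sign σ : ℤ) : ℂ) = ε at hσ
    rw [mul_div_mul_left _ _ hσ, mul_div_mul_left _ _ hσ]

end EllipticCM

/-- `1 / w² - 1 / (4 sin² (w / 2))` extends analytically to the origin. -/
theorem exists_analyticAt_inv_sq_sub_inv_sin_sq : ∃ K : ℝ → ℂ, AnalyticAt ℝ K 0 ∧
    ∀ᶠ w in 𝓝 (0 : ℝ), Real.sin (w / 2) ≠ 0 →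
      1 / (w : ℂ) ^ 2 - 1 / (4 * (Real.sin (w / 2) : ℂ) ^ 2) = K w := by
  obtain ⟨u, hu, hu0, hsu⟩ := exists_sin_half_eq_mul 0 (by simp)
  have hu0' : u 0 = 1 / 2 := by rw [hu0]; simp
  simp only [sub_zero] at hsu
  have hneg : Tendsto (fun w : ℝ => -w) (𝓝 0) (𝓝 0) := by
    simpa using (continuous_neg (G := ℝ)).tendsto 0
  have hue : ∀ᶠ w in 𝓝 (0 : ℝ), u (-w) = u w := by
    filter_upwards [hsu, hneg.eventually hsu] with w h1 h2
    by_cases hw : w = 0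
    · simp [hw]
    · rw [neg_div, Real.sin_neg, Complex.ofReal_neg, h1, Complex.ofReal_neg, neg_mul,
        neg_inj] at h2
      exact (mul_left_cancel₀ (Complex.ofReal_ne_zero.2 hw) h2).symm
  have he : AnalyticAt ℝ (fun w => 4 * u w ^ 2 - 1) 0 :=
    (analyticAt_const.fun_mul (hu.fun_pow 2)).fun_sub analyticAt_const
  obtain ⟨e, hea, hee⟩ := he.exists_eq_mul_of_eq_zero (ContinuousLinearMap.id ℝ ℝ) 1 rfl
    (Eventually.of_forall fun x hx => by
      simp only [ContinuousLinearMap.id_apply] at hx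
      rw [hx, hu0']; norm_num)
  simp only [ContinuousLinearMap.id_apply, sub_zero] at hee
  have he0 : e 0 = 0 := by
    have h1 : Tendsto (fun w : ℝ => e (-w)) (𝓝[≠] 0) (𝓝 (e 0)) :=
      (hea.continuousAt.tendsto.comp hneg).mono_left nhdsWithin_le_nhds
    have h2 : Tendsto (fun w : ℝ => -e w) (𝓝[≠] 0) (𝓝 (-e 0)) :=
      (hea.continuousAt.tendsto.mono_left nhdsWithin_le_nhds).neg
    refine self_eq_neg.1 (tendsto_nhds_unique (h1.congr' ?_) h2)
    filter_upwards [mem_nhdsWithin_of_mem_nhds hue, mem_nhdsWithin_of_mem_nhds hee,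
      mem_nhdsWithin_of_mem_nhds (hneg.eventually hee), self_mem_nhdsWithin] with w h3 h4 h5 hw
    rw [h3, h4, Complex.ofReal_neg] at h5
    exact mul_left_cancel₀ (Complex.ofReal_ne_zero.2 hw) (by linear_combination h5)
  obtain ⟨v, hva, hev⟩ := hea.exists_eq_mul_of_eq_zero (ContinuousLinearMap.id ℝ ℝ) 1 rfl
    (Eventually.of_forall fun x hx => by
      simp only [ContinuousLinearMap.id_apply] at hx
      rw [hx, he0])
  simp only [ContinuousLinearMap.id_apply, sub_zero] at hev
  have hune : u 0 ≠ 0 := by rw [hu0']; norm_num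
  refine ⟨fun w => v w / (4 * u w ^ 2), hva.fun_div (analyticAt_const.fun_mul (hu.fun_pow 2))
    (mul_ne_zero (by norm_num) (pow_ne_zero _ hune)), ?_⟩
  filter_upwards [hsu, hee, hev, hu.continuousAt.eventually_ne hune] with w h1 h2 h3 h4 hw
  have hw0 : (w : ℂ) ≠ 0 := fun h => hw (by rw [Complex.ofReal_eq_zero.1 h]; simp)
  rw [h3] at h2
  rw [h1]
  field_simp
  linear_combination h2

namespace EllipticCM

theorem mem_lattice_periods_iff (τ : UpperHalfPlane) {z : ℂ} :
    z ∈ (periods τ).lattice ↔ ∃ m n : ℤ, 2 * Real.pi * (m + n * (τ : ℂ)) = z := by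
  rw [PeriodPair.mem_lattice]
  refine exists_congr fun m => exists_congr fun n => ?_
  rw [show (m : ℂ) * (periods τ).ω₁ + n * (periods τ).ω₂ = 2 * Real.pi * (m + n * (τ : ℂ)) by
    simp only [periods]; ring]

theorem ofReal_mem_lattice_periods_iff (τ : UpperHalfPlane) {z : ℝ} :
    (z : ℂ) ∈ (periods τ).lattice ↔ Real.sin (z / 2) = 0 := by
  rw [mem_lattice_periods_iff, Real.sin_eq_zero_iff]
  constructor
  · rintro ⟨m, n, h⟩
    have him := congrArg Complex.im h
    have hn : (n : ℝ) = 0 := by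
      have h1 : 2 * Real.pi * ((n : ℝ) * τ.im) = 0 := by simpa using him
      have hτ := τ.im_pos
      have := Real.pi_pos
      rcases mul_eq_zero.1 h1 with h | h
      · linarith
      · exact (mul_eq_zero.1 h).resolve_right hτ.ne'
    have hn' : n = 0 := by exact_mod_cast hn
    subst hn'
    refine ⟨m, ?_⟩
    have : ((2 * Real.pi * m : ℝ) : ℂ) = z := by rw [← h]; push_cast; ring
    have := Complex.ofReal_injective this
    linarith
  · rintro ⟨m, h⟩
    refine ⟨m, 0, ?_⟩
    have : z = 2 * Real.pi * m := by linarith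
    rw [this]
    push_cast
    ring

theorem preserves_gaugedHamiltonian_wp (N : ℕ) (β : ℂ) (τ : UpperHalfPlane) :
    Preserves (gaugedHamiltonian N β (wp τ)) := by
  refine preserves_gaugedHamiltonian (fun z => ?_) (fun z => ?_) (fun z₀ => ?_) β
  · rw [Complex.ofReal_neg]
    exact (periods τ).weierstrassP_neg z
  · have := (periods τ).weierstrassP_add_coe z ⟨_, (periods τ).ω₁_mem_lattice⟩
    simpa [wp, periods] using this
  · by_cases h0 : Real.sin (z₀ / 2) = 0
    · obtain ⟨K, hK, hKe⟩ := exists_analyticAt_inv_sq_sub_inv_sin_sq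
      have hl : (z₀ : ℂ) ∈ (periods τ).lattice := (ofReal_mem_lattice_periods_iff τ).2 h0
      have hsub : Tendsto (fun z : ℝ => z - z₀) (𝓝 z₀) (𝓝 0) := by
        have : Continuous fun z : ℝ => z - z₀ := by fun_prop
        simpa using this.tendsto z₀
      have a1 : AnalyticAt ℝ (fun z : ℝ => (periods τ).weierstrassPExcept z₀ (z : ℂ)) z₀ :=
        AnalyticAt.fun_comp (g := (periods τ).weierstrassPExcept z₀) (f := Complex.ofRealCLM)
          ((periods τ).analyticAt_weierstrassPExcept z₀).restrictScalars
          (Complex.ofRealCLM.analyticAt z₀)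
      have a2 : AnalyticAt ℝ (fun z : ℝ => K (z - z₀)) z₀ :=
        AnalyticAt.fun_comp (g := K) (f := fun z : ℝ => z - z₀) (by simpa using hK)
          (analyticAt_id.fun_sub analyticAt_const)
      refine ⟨fun z => (periods τ).weierstrassPExcept z₀ z - 1 / (z₀ : ℂ) ^ 2 + K (z - z₀),
        (a1.fun_sub analyticAt_const).fun_add a2, ?_⟩
      filter_upwards [hsub.eventually hKe] with z hz hs
      obtain ⟨m, hm⟩ := Real.sin_eq_zero_iff.1 h0
      have h1 : Real.sin ((z - z₀) / 2) = (-1) ^ m * Real.sin (z / 2) := by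
        rw [sub_div, ← hm, Real.sin_sub_int_mul_pi]
      have h2 : (Real.sin ((z - z₀) / 2) : ℂ) ^ 2 = (Real.sin (z / 2) : ℂ) ^ 2 := by
        rw [h1, ← Complex.ofReal_pow, mul_pow, ← zpow_natCast, ← zpow_mul, mul_comm m,
          zpow_mul]
        norm_num
      have h3 := hz (by rw [h1]; exact mul_ne_zero (zpow_ne_zero _ (by norm_num)) hs)
      rw [h2] at h3
      rw [← h3, wp, ← (periods τ).weierstrassPExcept_add ⟨z₀, hl⟩]
      push_cast
      ring
    · have hl : (z₀ : ℂ) ∉ (periods τ).lattice := fun h =>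
        h0 ((ofReal_mem_lattice_periods_iff τ).1 h)
      refine ⟨fun z => wp τ z - 1 / (4 * (Real.sin (z / 2) : ℂ) ^ 2), ?_,
        Eventually.of_forall fun _ _ => rfl⟩
      have a1 : AnalyticAt ℝ (fun z : ℝ => wp τ z) z₀ :=
        AnalyticAt.fun_comp (g := wp τ) (f := Complex.ofRealCLM)
          ((periods τ).analyticOnNhd_weierstrassP _ hl).restrictScalars
          (Complex.ofRealCLM.analyticAt z₀)
      have a2 : AnalyticAt ℝ (fun z : ℝ => Real.sin (z / 2)) z₀ := by fun_prop
      have a3 : AnalyticAt ℝ (fun z : ℝ => (Real.sin (z / 2) : ℂ)) z₀ :=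
        (Complex.ofRealCLM.analyticAt _).fun_comp a2
      exact a1.fun_sub (analyticAt_const.fun_div (analyticAt_const.fun_mul (a3.fun_pow 2))
        (mul_ne_zero (by norm_num) (pow_ne_zero _ (Complex.ofReal_ne_zero.2 h0))))

theorem preserves_gaugedHamiltonian_wpTrig (N : ℕ) (β : ℂ) :
    Preserves (gaugedHamiltonian N β wpTrig) := by
  have h : ∀ z : ℝ, wpTrig z = 1 / (4 * (Real.sin (z / 2) : ℂ) ^ 2) - 1 / 12 := fun z => by
    simp [wpTrig]
  refine preserves_gaugedHamiltonian (fun z => ?_) (fun z => ?_) (fun z₀ => ?_) β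
  · rw [h, h, neg_div, Real.sin_neg, Complex.ofReal_neg, neg_sq]
  · have h2 : (z + 2 * Real.pi) / 2 = z / 2 + Real.pi := by ring
    simp only [h, h2, Real.sin_add_pi, Complex.ofReal_neg, neg_sq]
  · exact ⟨fun _ => -(1 / 12), analyticAt_const, Eventually.of_forall fun z _ => by rw [h]; ring⟩

theorem preserves_gaugedHasegawa_thetaTrig (N : ℕ) (β : ℂ) (i : ℕ) :
    Preserves (gaugedHasegawa N β thetaTrig i) := by
  have hπ : (Real.pi : ℂ) ≠ 0 := Complex.ofReal_ne_zero.2 Real.pi_ne_zero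
  refine preserves_gaugedHasegawa (r := fun _ => 1 / Real.pi) (fun _ => analyticAt_const)
    (fun _ => one_div_ne_zero hπ) (fun _ => rfl) (fun _ => rfl) (fun z => ?_) β i
  rw [thetaTrig, show (Real.pi : ℂ) * (z / (2 * Real.pi)) = ((z / 2 : ℝ) : ℂ) by
    push_cast; field_simp, ← Complex.ofReal_sin]
  ring

end EllipticCM

/-! ### The product expansion of the theta function -/

/-- The product `∏ (1 - p^(n+1) w)`. -/
noncomputable def qProd (p w : ℂ) : ℂ := ∏' n : ℕ, (1 - p ^ (n + 1) * w)

theorem summable_norm_pow_succ_mul {p : ℂ} (hp : ‖p‖ < 1) (w : ℂ) :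
    Summable fun n : ℕ => ‖-(p ^ (n + 1) * w)‖ := by
  have := ((summable_nat_add_iff 1).2 (summable_geometric_of_lt_one (norm_nonneg p) hp)).mul_right ‖w‖
  simpa using this

theorem differentiable_qProd {p : ℂ} (hp : ‖p‖ < 1) : Differentiable ℂ (qProd p) := by
  intro w
  have hs := ((summable_nat_add_iff 1).2
    (summable_geometric_of_lt_one (norm_nonneg p) hp)).mul_right (‖w‖ + 1)
  have h := hs.hasProdLocallyUniformlyOn_nat_one_add (f := fun n w => -(p ^ (n + 1) * w))
    (Metric.isOpen_ball (x := (0 : ℂ)) (ε := ‖w‖ + 1)) (Eventually.of_forall fun n x hx => by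
      rw [norm_neg, norm_mul, norm_pow]
      gcongr
      exact (mem_ball_zero_iff.1 hx).le) (fun n => by fun_prop)
  have hd : DifferentiableOn ℂ (fun w => ∏' n : ℕ, (1 + -(p ^ (n + 1) * w)))
      (Metric.ball 0 (‖w‖ + 1)) := h.differentiableOn
    (.of_forall fun _ ↦ by simpa [Finset.prod_fn] using
      DifferentiableOn.finsetProd (fun _ _ ↦ by fun_prop)) Metric.isOpen_ball
  exact hd.differentiableAt (Metric.isOpen_ball.mem_nhds (by simp))

theorem qProd_ne_zero {p : ℂ} (hp : ‖p‖ < 1) {w : ℂ} (hw : ∀ n : ℕ, p ^ (n + 1) * w ≠ 1) :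
    qProd p w ≠ 0 :=
  tprod_one_add_ne_zero_of_summable (f := fun n : ℕ => -(p ^ (n + 1) * w))
    (fun n h => hw n (by linear_combination -h)) (summable_norm_pow_succ_mul hp w)

theorem qProd_eq_mul {p : ℂ} (hp : ‖p‖ < 1) (w : ℂ) :
    qProd p w = (1 - p * w) * qProd p (p * w) := by
  have hm' : Multipliable fun n : ℕ => 1 - p ^ (n + 1 + 1) * w := by
    have := multipliable_one_add_of_summable (summable_norm_pow_succ_mul hp (p * w))
    refine this.congr fun n => ?_
    ring
  rw [qProd, qProd, tprod_eq_zero_mul' (f := fun n : ℕ => 1 - p ^ (n + 1) * w) hm']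
  simp only [zero_add, pow_one]
  congr 1
  exact tprod_congr fun n => by ring

theorem jacobiTheta₂_ne_zero_of_im {τ : ℂ} (hτ : 0 < τ.im) (a : ℂ) :
    ∃ x : ℝ, jacobiTheta₂ (x + a) τ ≠ 0 := by
  by_contra! h
  have hs : HasSum (fun n : ℤ => ∫ x in (0 : ℝ)..1, jacobiTheta₂_term n (x + a) τ)
      (∫ x in (0 : ℝ)..1, (0 : ℂ)) := by
    have hb := summable_pow_mul_jacobiTheta₂_term_bound |a.im| hτ 0
    refine intervalIntegral.hasSum_integral_of_dominated_convergence
      (fun n _ => Real.exp (-Real.pi * (τ.im * n ^ 2 - 2 * |a.im| * |n|))) (fun n => ?_)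
      (fun n => ?_) ?_ ?_ ?_
    · refine Continuous.aestronglyMeasurable ?_
      unfold jacobiTheta₂_term
      fun_prop
    · refine Eventually.of_forall fun t _ => ?_
      exact norm_jacobiTheta₂_term_le hτ (by simp) le_rfl n
    · exact Eventually.of_forall fun t _ => by simpa using hb
    · exact intervalIntegrable_const
    · exact Eventually.of_forall fun t _ => by
        simpa only [h] using hasSum_jacobiTheta₂_term (t + a) hτ
  have hn : ∀ n : ℤ, n ≠ 0 → ∫ x in (0 : ℝ)..1, jacobiTheta₂_term n (x + a) τ = 0 := by
    intro n hn
    have hc : 2 * (Real.pi : ℂ) * I * n ≠ 0 := by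
      simp [hn, Real.pi_ne_zero]
    have : ∀ x : ℝ, jacobiTheta₂_term n (x + a) τ =
        Complex.exp (2 * Real.pi * I * n * x) *
          Complex.exp (2 * Real.pi * I * n * a + Real.pi * I * n ^ 2 * τ) := fun x => by
      rw [jacobiTheta₂_term, ← Complex.exp_add]
      ring_nf
    simp only [this]
    rw [intervalIntegral.integral_mul_const, integral_exp_mul_complex hc]
    have h1 : Complex.exp (2 * Real.pi * I * n * ((1 : ℝ) : ℂ)) = 1 := by
      rw [Complex.exp_eq_one_iff]
      exact ⟨n, by push_cast; ring⟩
    rw [h1]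
    simp
  have h0 := hs.unique (hasSum_single 0 hn)
  simp [jacobiTheta₂_term] at h0

namespace EllipticCM

theorem thetaOne_eq (τ : UpperHalfPlane) (x : ℂ) :
    thetaOne τ x = -I * Complex.exp (Real.pi * I * (τ / 4 + x)) *
      jacobiTheta₂ (x + (1 / 2 + τ / 2)) τ := by
  have hs := (hasSum_jacobiTheta₂_term (x + (1 / 2 + τ / 2)) τ.im_pos).mul_left
    (-I * Complex.exp (Real.pi * I * (τ / 4 + x)))
  have hs' := hs.nat_add_neg_add_one
  rw [← hs'.tsum_eq, thetaOne, ← tsum_mul_left]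
  refine tsum_congr fun n => ?_
  have hterm : ∀ m : ℤ, Complex.exp (Real.pi * I * (τ / 4 + x)) *
      jacobiTheta₂_term m (x + (1 / 2 + τ / 2)) τ = (-1) ^ m *
        Complex.exp (τ * Real.pi * I * (m + 1 / 2) ^ 2) *
          Complex.exp ((2 * m + 1) * Real.pi * x * I) := by
    intro m
    have h1 : ((-1 : ℂ)) ^ m = Complex.exp (Real.pi * I * m) := by
      rw [mul_comm (Real.pi * I : ℂ), Complex.exp_int_mul, Complex.exp_pi_mul_I]
    rw [jacobiTheta₂_term, h1, ← Complex.exp_add, ← Complex.exp_add, ← Complex.exp_add]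
    congr 1
    ring
  have h2 : ((-1 : ℂ)) ^ (-((n : ℤ) + 1)) = -(-1) ^ n := by
    rw [zpow_neg, ← inv_zpow, zpow_add₀ (by norm_num)]
    norm_num
  rw [mul_assoc (-I), mul_assoc (-I), hterm, hterm, h2, zpow_natCast, Complex.sin]
  push_cast
  have h3 : (τ : ℂ) * Real.pi * I * (-1 + -(n : ℂ) + 1 / 2) ^ 2 =
      τ * Real.pi * I * (n + 1 / 2) ^ 2 := by ring
  have h4 : (2 * (-1 + -(n : ℂ)) + 1) * Real.pi * x * I = -((2 * n + 1) * Real.pi * x) * I := by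
    ring
  simp only [neg_add_rev, h3, h4]
  ring

theorem differentiable_thetaOne (τ : UpperHalfPlane) : Differentiable ℂ (thetaOne τ) := by
  intro x
  rw [funext (thetaOne_eq τ)]
  have h1 : DifferentiableAt ℂ (fun x : ℂ => jacobiTheta₂ (x + (1 / 2 + τ / 2)) τ) x :=
    DifferentiableAt.fun_comp' (g := fun z => jacobiTheta₂ z τ) x
      (differentiableAt_jacobiTheta₂_fst _ τ.im_pos) (by fun_prop)
  exact DifferentiableAt.fun_mul (by fun_prop) h1

theorem thetaOne_add_one (τ : UpperHalfPlane) (x : ℂ) : thetaOne τ (x + 1) = -thetaOne τ x := by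
  rw [thetaOne_eq, thetaOne_eq, add_right_comm, jacobiTheta₂_add_left, ← add_assoc, mul_add,
    mul_one, Complex.exp_add, Complex.exp_pi_mul_I]
  ring

theorem thetaOne_add_tau (τ : UpperHalfPlane) (x : ℂ) :
    thetaOne τ (x + τ) = -Complex.exp (-(Real.pi * I * τ) - 2 * Real.pi * I * x) * thetaOne τ x := by
  have h : Complex.exp (Real.pi * I * (τ / 4 + (x + τ))) *
      Complex.exp (-Real.pi * I * (τ + 2 * (x + (1 / 2 + τ / 2)))) =
      -Complex.exp (-(Real.pi * I * τ) - 2 * Real.pi * I * x) *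
        Complex.exp (Real.pi * I * (τ / 4 + x)) := by
    have h1 : ∀ a b : ℂ, -Complex.exp a * Complex.exp b = Complex.exp (Real.pi * I + a + b) := by
      intro a b
      rw [Complex.exp_add, Complex.exp_add, Complex.exp_pi_mul_I]
      ring
    rw [h1, ← Complex.exp_add, Complex.exp_eq_exp_iff_exists_int]
    exact ⟨-1, by push_cast; ring⟩
  rw [thetaOne_eq, thetaOne_eq, add_right_comm, jacobiTheta₂_add_left']
  linear_combination (-I * jacobiTheta₂ (x + (1 / 2 + τ / 2)) τ) * h

/-- The nome squared, `p = exp (2π i τ)`. -/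
noncomputable def nome (τ : UpperHalfPlane) : ℂ := Complex.exp (2 * Real.pi * I * τ)

theorem norm_nome_lt_one (τ : UpperHalfPlane) : ‖nome τ‖ < 1 :=
  UpperHalfPlane.norm_exp_two_pi_I_lt_one τ

/-- The product `∏ (1 - p^n e^{iz}) (1 - p^n e^{-iz})`. -/
noncomputable def thetaFactor (τ : UpperHalfPlane) (z : ℂ) : ℂ :=
  qProd (nome τ) (Complex.exp (I * z)) * qProd (nome τ) (Complex.exp (-(I * z)))

theorem differentiable_thetaFactor (τ : UpperHalfPlane) : Differentiable ℂ (thetaFactor τ) := by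
  have h := differentiable_qProd (norm_nome_lt_one τ)
  exact (h.comp (f := fun z => Complex.exp (I * z)) (by fun_prop)).mul
    (h.comp (f := fun z => Complex.exp (-(I * z))) (by fun_prop))

theorem nome_pow_mul_exp (τ : UpperHalfPlane) (n : ℕ) (z : ℂ) :
    nome τ ^ (n + 1) * Complex.exp (I * z) =
      Complex.exp (I * (z + 2 * Real.pi * ((n + 1 : ℕ) * (τ : ℂ)))) := by
  rw [nome, ← Complex.exp_nat_mul, ← Complex.exp_add]
  congr 1
  ring

theorem thetaFactor_ne_zero (τ : UpperHalfPlane) {z : ℂ}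
    (hz : ∀ m n : ℤ, n ≠ 0 → 2 * Real.pi * (m + n * (τ : ℂ)) ≠ z) : thetaFactor τ z ≠ 0 := by
  refine mul_ne_zero (qProd_ne_zero (norm_nome_lt_one τ) fun n h => ?_)
    (qProd_ne_zero (norm_nome_lt_one τ) fun n h => ?_)
  · rw [nome_pow_mul_exp, Complex.exp_eq_one_iff] at h
    obtain ⟨m, hm⟩ := h
    refine hz m (-((n : ℤ) + 1)) (by omega) ?_
    push_cast at hm ⊢
    linear_combination I * hm - (z + 2 * Real.pi * ((n + 1) * τ) - m * (2 * Real.pi)) * I_sq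
  · rw [← mul_neg, nome_pow_mul_exp, Complex.exp_eq_one_iff] at h
    obtain ⟨m, hm⟩ := h
    refine hz (-m) ((n : ℤ) + 1) (by omega) ?_
    push_cast at hm ⊢
    linear_combination -I * hm + (-z + 2 * Real.pi * ((n + 1) * τ) - m * (2 * Real.pi)) * I_sq

theorem thetaFactor_ofReal_ne_zero (τ : UpperHalfPlane) (z : ℝ) : thetaFactor τ z ≠ 0 :=
  thetaFactor_ne_zero τ fun m n hn h => by
    have him := congrArg Complex.im h
    have h1 : Real.pi = 0 ∨ n = 0 ∨ τ.im = 0 := by simpa using him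
    rcases h1 with h | h | h
    · exact Real.pi_ne_zero h
    · exact hn h
    · exact τ.im_pos.ne' h

theorem thetaFactor_neg (τ : UpperHalfPlane) (z : ℂ) : thetaFactor τ (-z) = thetaFactor τ z := by
  rw [thetaFactor, thetaFactor, mul_neg, neg_neg, mul_comm]

theorem thetaFactor_add_two_pi (τ : UpperHalfPlane) (z : ℂ) :
    thetaFactor τ (z + 2 * Real.pi) = thetaFactor τ z := by
  have h1 : Complex.exp (I * (z + 2 * Real.pi)) = Complex.exp (I * z) := by
    rw [Complex.exp_eq_exp_iff_exists_int]
    exact ⟨1, by push_cast; ring⟩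
  have h2 : Complex.exp (-(I * (z + 2 * Real.pi))) = Complex.exp (-(I * z)) := by
    rw [Complex.exp_eq_exp_iff_exists_int]
    exact ⟨-1, by push_cast; ring⟩
  rw [thetaFactor, h1, h2, thetaFactor]

/-- The product side of the expansion of the theta function. -/
noncomputable def thetaProd (τ : UpperHalfPlane) (z : ℂ) : ℂ :=
  Complex.sin (z / 2) * thetaFactor τ z

theorem differentiable_thetaProd (τ : UpperHalfPlane) : Differentiable ℂ (thetaProd τ) :=
  Differentiable.mul (by fun_prop) (differentiable_thetaFactor τ)

theorem thetaProd_add_two_pi (τ : UpperHalfPlane) (z : ℂ) :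
    thetaProd τ (z + 2 * Real.pi) = -thetaProd τ z := by
  rw [thetaProd, thetaProd, thetaFactor_add_two_pi, add_div, mul_div_cancel_left₀ _ two_ne_zero,
    Complex.sin_add_pi, neg_mul]

theorem thetaProd_add_tau (τ : UpperHalfPlane) (z : ℂ) :
    thetaProd τ (z + 2 * Real.pi * τ) =
      -Complex.exp (-(Real.pi * I * τ) - I * z) * thetaProd τ z := by
  set q := Complex.exp (Real.pi * I * τ) with hq
  set w := Complex.exp (I * z / 2) with hw
  have hq0 : q ≠ 0 := Complex.exp_ne_zero _
  have hw0 : w ≠ 0 := Complex.exp_ne_zero _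
  have hp : nome τ = q ^ 2 := by rw [nome, hq, ← Complex.exp_nat_mul]; congr 1; push_cast; ring
  have e1 : Complex.exp (I * z) = w ^ 2 := by
    rw [hw, ← Complex.exp_nat_mul]; congr 1; push_cast; ring
  have e2 : Complex.exp (-(I * z)) = (w ^ 2)⁻¹ := by rw [Complex.exp_neg, e1]
  have e3 : Complex.exp (I * (z + 2 * Real.pi * τ)) = q ^ 2 * w ^ 2 := by
    rw [← hp, ← e1, nome, ← Complex.exp_add]; congr 1; ring
  have e4 : Complex.exp (-(I * (z + 2 * Real.pi * τ))) = (q ^ 2 * w ^ 2)⁻¹ := by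
    rw [Complex.exp_neg, e3]
  have e5 : Complex.sin (z / 2) = (w⁻¹ - w) * I / 2 := by
    rw [Complex.sin, hw, ← Complex.exp_neg]
    congr 4 <;> ring
  have e6 : Complex.sin ((z + 2 * Real.pi * τ) / 2) = ((q * w)⁻¹ - q * w) * I / 2 := by
    rw [Complex.sin, hq, hw, ← Complex.exp_add, ← Complex.exp_neg]
    congr 4 <;> ring
  have e7 : Complex.exp (-(Real.pi * I * τ) - I * z) = q⁻¹ * (w ^ 2)⁻¹ := by
    rw [Complex.exp_sub, Complex.exp_neg, ← hq, e1, div_eq_mul_inv]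
  have f1 := qProd_eq_mul (norm_nome_lt_one τ) (w ^ 2)
  have f2 := qProd_eq_mul (norm_nome_lt_one τ) ((q ^ 2 * w ^ 2)⁻¹)
  rw [hp] at f1 f2
  have f3 : q ^ 2 * (q ^ 2 * w ^ 2)⁻¹ = (w ^ 2)⁻¹ := by field_simp
  rw [f3] at f2
  rw [thetaProd, thetaProd, thetaFactor, thetaFactor, e1, e2, e3, e4, e5, e6, e7, hp, f1, f2]
  field_simp
  ring

/-- The theta function is a nonzero multiple of the product, away from the period lattice. -/
theorem exists_thetaOne_eq_mul_thetaProd (τ : UpperHalfPlane) :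
    ∃ c : ℂ, deriv (thetaOne τ) 0 = c * Real.pi * thetaFactor τ 0 ∧
      ∀ z ∉ (periods τ).lattice, thetaOne τ (z / (2 * Real.pi)) = c * thetaProd τ z := by
  classical
  set Λ := (periods τ).lattice with hΛ
  let T : ℂ → ℂ := fun z => thetaOne τ (z / (2 * Real.pi))
  let A : ℂ → ℂ := thetaProd τ
  have hπ : (Real.pi : ℂ) ≠ 0 := Complex.ofReal_ne_zero.2 Real.pi_ne_zero
  have hT : Differentiable ℂ T := (differentiable_thetaOne τ).comp (by fun_prop)
  have hA : Differentiable ℂ A := differentiable_thetaProd τ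
  have hT0 : T 0 = 0 := by simp [T, thetaOne]
  have hA0 : A 0 = 0 := by simp [A, thetaProd]
  have hf0 : thetaFactor τ 0 ≠ 0 := by simpa using thetaFactor_ofReal_ne_zero τ 0
  have hAd : deriv A 0 = thetaFactor τ 0 / 2 := by
    have h1 : HasDerivAt (fun z : ℂ => Complex.sin (z / 2)) (Complex.cos (0 / 2) * (1 / 2)) 0 :=
      ((hasDerivAt_id (0 : ℂ)).div_const 2).csin
    have h2 := (h1.mul (differentiable_thetaFactor τ 0).hasDerivAt).deriv
    rw [show A = (fun z : ℂ => Complex.sin (z / 2)) * thetaFactor τ from rfl, h2]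
    simp
    ring
  have hTd : deriv T 0 = deriv (thetaOne τ) 0 / (2 * Real.pi) := by
    have h1 : HasDerivAt (fun z : ℂ => z / (2 * (Real.pi : ℂ))) (1 / (2 * Real.pi)) 0 :=
      (hasDerivAt_id (0 : ℂ)).div_const _
    have h2 : HasDerivAt (thetaOne τ) (deriv (thetaOne τ) 0) (0 / (2 * (Real.pi : ℂ))) := by
      rw [zero_div]; exact (differentiable_thetaOne τ 0).hasDerivAt
    have h3 := (h2.comp (0 : ℂ) h1).deriv
    rw [show T = thetaOne τ ∘ fun z : ℂ => z / (2 * (Real.pi : ℂ)) from rfl, h3]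
    ring
  have hAΛ : ∀ z ∉ Λ, A z ≠ 0 := by
    intro z hz
    rw [hΛ, mem_lattice_periods_iff] at hz
    push Not at hz
    refine mul_ne_zero (fun h => ?_) (thetaFactor_ne_zero τ fun m n _ => hz m n)
    obtain ⟨m, hm⟩ := Complex.sin_eq_zero_iff.1 h
    refine hz m 0 ?_
    push_cast
    linear_combination -2 * hm
  let F : ℂ → ℂ := fun z => if z ∈ Λ then deriv T 0 / deriv A 0 else T z / A z
  have hper₁ : ∀ z, F (z + 2 * Real.pi) = F z := by
    intro z
    have h1 : z + 2 * Real.pi ∈ Λ ↔ z ∈ Λ := Λ.add_mem_iff_left (periods τ).ω₁_mem_lattice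
    have h2 : T (z + 2 * Real.pi) = -T z := by
      simp only [T]
      rw [add_div, div_self (mul_ne_zero two_ne_zero hπ), thetaOne_add_one]
    simp only [F, h1, h2, A, thetaProd_add_two_pi, neg_div_neg_eq]
  have hper₂ : ∀ z, F (z + 2 * Real.pi * τ) = F z := by
    intro z
    have h1 : z + 2 * Real.pi * τ ∈ Λ ↔ z ∈ Λ := Λ.add_mem_iff_left (periods τ).ω₂_mem_lattice
    have h2 : T (z + 2 * Real.pi * τ) = -Complex.exp (-(Real.pi * I * τ) - I * z) * T z := by
      simp only [T]
      rw [add_div, mul_div_cancel_left₀ _ (mul_ne_zero two_ne_zero hπ), thetaOne_add_tau]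
      congr 4
      field_simp
    simp only [F, h1, h2, A, thetaProd_add_tau]
    rw [mul_div_mul_left _ _ (neg_ne_zero.2 (Complex.exp_ne_zero _))]
  have hper : ∀ z l, l ∈ Λ → F (z + l) = F z := by
    have h1 : Function.Periodic F (2 * Real.pi) := hper₁
    have h2 : Function.Periodic F (2 * Real.pi * τ) := hper₂
    intro z l hl
    obtain ⟨m, n, rfl⟩ := (mem_lattice_periods_iff τ).1 hl
    rw [show z + 2 * Real.pi * (m + n * (τ : ℂ)) =
      z + n * (2 * Real.pi * τ) + m * (2 * Real.pi) by ring, h1.int_mul m, h2.int_mul n]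
  have hFd0 : DifferentiableAt ℂ F 0 := by
    have hd0 : dslope A 0 0 ≠ 0 := by
      rw [dslope_same, hAd]; exact div_ne_zero hf0 two_ne_zero
    have dT : DifferentiableAt ℂ (dslope T 0) 0 :=
      ((Complex.differentiableOn_dslope univ_mem).2 hT.differentiableOn).differentiableAt univ_mem
    have dA : DifferentiableAt ℂ (dslope A 0) 0 :=
      ((Complex.differentiableOn_dslope univ_mem).2 hA.differentiableOn).differentiableAt univ_mem
    refine (dT.fun_div dA hd0).congr_of_eventuallyEq ?_
    filter_upwards [(periods τ).compl_lattice_sdiff_singleton_mem_nhds 0] with z hz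
    by_cases h0 : z = 0
    · subst h0
      simp [F, dslope_same, zero_mem]
    · have hzΛ : z ∉ Λ := fun h => hz ⟨h, h0⟩
      simp only [F, if_neg hzΛ]
      rw [dslope_of_ne _ h0, dslope_of_ne _ h0, slope_def_field, slope_def_field, hT0, hA0]
      have := hAΛ z hzΛ
      field_simp
      ring
  have hFd : Differentiable ℂ F := by
    intro z
    by_cases hz : z ∈ Λ
    · have h1 : F = fun y => F (y - z) := by
        funext y
        rw [← hper (y - z) z hz, sub_add_cancel]
      rw [h1]
      exact DifferentiableAt.fun_comp' (g := F) (f := fun y => y - z) z (by simpa using hFd0)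
        (by fun_prop)
    · refine ((hT z).fun_div (hA z) (hAΛ z hz)).congr_of_eventuallyEq ?_
      filter_upwards [(periods τ).isClosed_lattice.isOpen_compl.mem_nhds hz] with y hy
      exact if_neg hy
  have hconst : ∀ z, F z = F 0 := fun z =>
    hFd.apply_eq_apply_of_bounded (IsZLattice.isCompact_range_of_periodic Λ F hFd.continuous
      hper).isBounded z 0
  have hF0 : F 0 = deriv T 0 / deriv A 0 := if_pos (zero_mem _)
  refine ⟨F 0, ?_, fun z hz => ?_⟩
  · rw [hF0, hAd, hTd]
    field_simp
  · rw [← hconst z]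
    simp only [F, if_neg hz]
    rw [div_mul_cancel₀ _ (hAΛ z hz)]

theorem thetaOne_intCast (τ : UpperHalfPlane) (m : ℤ) : thetaOne τ m = 0 := by
  have : ∀ n : ℕ, Complex.sin ((2 * n + 1) * Real.pi * m) = 0 := fun n => by
    rw [Complex.sin_eq_zero_iff]
    exact ⟨(2 * n + 1) * m, by push_cast; ring⟩
  simp [thetaOne, this]

theorem exists_thetaOne_ne_zero (τ : UpperHalfPlane) : ∃ x : ℝ, thetaOne τ x ≠ 0 := by
  obtain ⟨x, hx⟩ := jacobiTheta₂_ne_zero_of_im τ.im_pos (1 / 2 + τ / 2)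
  refine ⟨x, ?_⟩
  rw [thetaOne_eq]
  exact mul_ne_zero (mul_ne_zero (neg_ne_zero.2 I_ne_zero) (Complex.exp_ne_zero _)) hx

theorem preserves_gaugedHasegawa_theta (N : ℕ) (β : ℂ) (τ : UpperHalfPlane) (i : ℕ) :
    Preserves (gaugedHasegawa N β (theta τ) i) := by
  obtain ⟨c, hd, hc⟩ := exists_thetaOne_eq_mul_thetaProd τ
  have hπ : (Real.pi : ℂ) ≠ 0 := Complex.ofReal_ne_zero.2 Real.pi_ne_zero
  have hreal : ∀ z : ℝ, thetaOne τ ((z : ℂ) / (2 * Real.pi)) = c * thetaProd τ z := by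
    intro z
    by_cases h : Real.sin (z / 2) = 0
    · obtain ⟨m, hm⟩ := Real.sin_eq_zero_iff.1 h
      have h1 : (z : ℂ) / (2 * Real.pi) = (m : ℤ) := by
        have : z = 2 * Real.pi * m := by linarith
        rw [this]; push_cast; field_simp
      have h2 : Complex.sin ((z : ℂ) / 2) = 0 := by
        have : Complex.sin ((z / 2 : ℝ) : ℂ) = 0 := by rw [← Complex.ofReal_sin, h]; rfl
        simpa using this
      rw [h1, thetaOne_intCast, thetaProd, h2]
      ring
    · exact hc z fun hz => h ((ofReal_mem_lattice_periods_iff τ).1 hz)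
  have hc0 : c ≠ 0 := by
    rintro rfl
    obtain ⟨x, hx⟩ := exists_thetaOne_ne_zero τ
    refine hx ?_
    have := hreal (2 * Real.pi * x)
    rwa [zero_mul, Complex.ofReal_mul, Complex.ofReal_mul, Complex.ofReal_ofNat,
      mul_div_cancel_left₀ _ (mul_ne_zero two_ne_zero hπ)] at this
  have hd0 : deriv (thetaOne τ) 0 ≠ 0 := by
    rw [hd]
    exact mul_ne_zero (mul_ne_zero hc0 hπ) (by simpa using thetaFactor_ofReal_ne_zero τ 0)
  refine preserves_gaugedHasegawa (r := fun z => c / deriv (thetaOne τ) 0 * thetaFactor τ z)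
    (fun z => ?_) (fun z => ?_) (fun z => ?_) (fun z => ?_) (fun z => ?_) β i
  · refine analyticAt_const.fun_mul ?_
    exact AnalyticAt.fun_comp (g := thetaFactor τ) (f := Complex.ofRealCLM)
      ((differentiable_thetaFactor τ).analyticAt _).restrictScalars (Complex.ofRealCLM.analyticAt z)
  · exact mul_ne_zero (div_ne_zero hc0 hd0) (thetaFactor_ofReal_ne_zero τ z)
  · rw [Complex.ofReal_neg, thetaFactor_neg]
  · have := thetaFactor_add_two_pi τ z
    push_cast
    rw [this]
  · rw [theta, hreal, thetaProd]
    push_cast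
    ring

end EllipticCM

end

theorem mainTheorem11 (N : ℕ) (β : ℂ) :
    (∀ τ : UpperHalfPlane,
      EllipticCM.Preserves (EllipticCM.gaugedHamiltonian N β (EllipticCM.wp τ)) ∧
      ∀ i : ℕ, 1 ≤ i → i ≤ N →
        EllipticCM.Preserves (EllipticCM.gaugedHasegawa N β (EllipticCM.theta τ) i)) ∧
    (EllipticCM.Preserves (EllipticCM.gaugedHamiltonian N β EllipticCM.wpTrig) ∧
      ∀ i : ℕ, 1 ≤ i → i ≤ N →
        EllipticCM.Preserves (EllipticCM.gaugedHasegawa N β EllipticCM.thetaTrig i)) :=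
  ⟨fun τ => ⟨EllipticCM.preserves_gaugedHamiltonian_wp N β τ,
    fun i _ _ => EllipticCM.preserves_gaugedHasegawa_theta N β τ i⟩,
    EllipticCM.preserves_gaugedHamiltonian_wpTrig N β,
    fun i _ _ => EllipticCM.preserves_gaugedHasegawa_thetaTrig N β i⟩
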